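/- Let $n\ge 1$, let $\mathbb{R}^n_+=\{x\in\mathbb{R}^n : x_1>0\}$, write $|\mathbf{X}_j|^2=x_1^2+\dots+x_j^2$ for $1\le j\le n$, and let $C_0^\infty(\mathbb{R}^n_+)$ be the set of smooth real-valued functions with compact support contained in the open half-space $\mathbb{R}^n_+$. Then for every $1\le k\le n$, $$\inf_{0\ne u\in C_0^\infty(\mathbb{R}^n_+)}\frac{\int_{\mathbb{R}^n_+}|\nabla u|^2\,dx}{\int_{\mathbb{R}^n_+}\frac{|u|^2}{|\mathbf{X}_k|^2}\,dx}=\frac{k^2}{4},$$ and for every integer $m$ with $k\le m<n$, $$\inf_{0\ne u\in C_0^\infty(\mathbb{R}^n_+)}\frac{\int_{\mathbb{R}^n_+}|\nabla u|^2\,dx-\frac{k^2}{4}\int_{\mathbb{R}^n_+}\frac{|u|^2}{|\mathbf{X}_k|^2}\,dx-\frac14\sum_{j=k+1}^{m}\int_{\mathbb{R}^n_+}\frac{|u|^2}{|\mathbf{X}_j|^2}\,dx}{\int_{\mathbb{R}^n_+}\frac{|u|^2}{|\mathbf{X}_{m+1}|^2}\,dx}=\frac14,$$ where the sum is empty if $m=k$.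 -/

import Mathlib

open MeasureTheory
open scoped ContDiff

/-- The open upper half-space `{x ∈ ℝⁿ : x₁ > 0}`; coordinates are indexed from `0`, so `x₁` is `x 0`. -/
def halfSpace (n : ℕ) [NeZero n] : Set (EuclideanSpace ℝ (Fin n)) :=
  {x | 0 < x 0}

/-- `x₁² + ⋯ + x_k²`, the sum of the squares of the first `k` coordinates of `x`
(meant for `k ≤ n`). -/
def sqNormFirst {n : ℕ} (k : ℕ) (x : EuclideanSpace ℝ (Fin n)) : ℝ :=
  ∑ i ∈ Finset.univ.filter (fun i : Fin n => (i : ℕ) < k), x i ^ 2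

/-- `u ∈ C₀^∞` of the open half-space: a smooth real function on `ℝⁿ` whose support is a
compact subset of the open half-space. -/
structure IsTestFunction (n : ℕ) [NeZero n] (u : EuclideanSpace ℝ (Fin n) → ℝ) : Prop where
  smooth : ContDiff ℝ ∞ u
  compact_support : HasCompactSupport u
  support_subset : tsupport u ⊆ halfSpace n

/-- The Dirichlet integral `∫ |∇u|² dx` over the half-space. -/
noncomputable def dirichletIntegral (n : ℕ) [NeZero n]
    (u : EuclideanSpace ℝ (Fin n) → ℝ) : ℝ :=
  ∫ x in halfSpace n, ‖gradient u x‖ ^ 2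

/-- The Hardy integral `∫ u² / (x₁² + ⋯ + x_k²) dx` over the half-space. -/
noncomputable def hardyIntegral (n : ℕ) [NeZero n] (k : ℕ)
    (u : EuclideanSpace ℝ (Fin n) → ℝ) : ℝ :=
  ∫ x in halfSpace n, |u x| ^ 2 / sqNormFirst k x

/-! Let φ = x₁ |X_k|^(-k/2) |X_{k+1}|^(-1/2) ⋯ |X_M|^(-1/2) and let F be its logarithmic gradient.
Expanding ∫ |∇u - u F|² and integrating the cross term by parts yields exactly the Dirichlet
integral minus the Hardy terms up to index M (`IsTestFunction.hardyDeficit_eq`). Nonnegativity with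
M = k and with M = m + 1 gives both lower bounds.

For sharpness, the homogeneity degrees of φ are raised by small numbers B j and the result is
multiplied by a Gaussian, giving v. Put J j = ∫ v²/|X_j|² and G = ∫ v². Completing the square shows
that the deficit of v is at most ∑ B_j² J_j + c G, the sum over k ≤ j ≤ M, with c depending only on
n (`tendsto_hardyDeficit_truncatedRadial`, `integral_gaussianRadial_norm_sq`). Integration by parts
against X_j/|X_j|² gives B_M J_M = G and B_j J_j ≤ G + ½ ∑_{j<i≤M} J_i
(`integral_gaussianRadial_headProj`). Choosing B_M, then B_{M-1}, down to B_k, each small relative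
to the previous choices, makes the deficit at most η J_M for any given η > 0, without evaluating any
integral (`exists_isPerturbation`). Cutoffs and dominated convergence then replace v by test
functions. -/

/-- The orthogonal projection of `ℝⁿ` onto the span of the first `j` coordinate vectors. -/
noncomputable def headProj {n : ℕ} (j : ℕ) :
    EuclideanSpace ℝ (Fin n) →L[ℝ] EuclideanSpace ℝ (Fin n) :=
  LinearMap.toContinuousLinearMap
    { toFun := fun x => WithLp.toLp 2 fun i => if (i : ℕ) < j then x i else 0
      map_add' := fun x y => by ext i; simp only [PiLp.add_apply]; split_ifs <;> simp
      map_smul' := fun c x => by ext i; simp }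

/-! ### Nested coordinate projections and their norms. -/

section Geometry

variable {n : ℕ}

@[simp]
theorem headProj_apply (j : ℕ) (x : EuclideanSpace ℝ (Fin n)) (i : Fin n) :
    headProj j x i = if (i : ℕ) < j then x i else 0 := rfl

theorem headProj_of_le {j : ℕ} (h : n ≤ j) (x : EuclideanSpace ℝ (Fin n)) :
    headProj j x = x := by
  ext i
  simp [i.isLt.trans_le h]

/-- The projections are nested, so only the smaller index survives. Every telescoping sum below
rests on this. -/
theorem inner_headProj_headProj {i j : ℕ} (h : i ≤ j) (x : EuclideanSpace ℝ (Fin n)) :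
    inner ℝ (headProj i x) (headProj j x) = sqNormFirst i x := by
  simp only [PiLp.inner_apply, headProj_apply, sqNormFirst, Finset.sum_filter]
  refine Finset.sum_congr rfl fun l _ => ?_
  by_cases hl : (l : ℕ) < i
  · simp [hl, hl.trans_le h, sq]
  · simp [hl]

theorem inner_headProj_left (j : ℕ) (x y : EuclideanSpace ℝ (Fin n)) :
    inner ℝ (headProj j x) (headProj j y) = inner ℝ (headProj j x) y := by
  simp only [PiLp.inner_apply, headProj_apply]
  refine Finset.sum_congr rfl fun l _ => ?_
  split_ifs <;> simp

theorem norm_headProj_sq (j : ℕ) (x : EuclideanSpace ℝ (Fin n)) :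
    ‖headProj j x‖ ^ 2 = sqNormFirst j x := by
  rw [← real_inner_self_eq_norm_sq, inner_headProj_headProj le_rfl]

theorem sqNormFirst_nonneg (j : ℕ) (x : EuclideanSpace ℝ (Fin n)) : 0 ≤ sqNormFirst j x :=
  Finset.sum_nonneg fun _ _ => sq_nonneg _

theorem sq_le_sqNormFirst {j : ℕ} (i : Fin n) (h : (i : ℕ) < j)
    (x : EuclideanSpace ℝ (Fin n)) : x i ^ 2 ≤ sqNormFirst j x :=
  Finset.single_le_sum (f := fun i : Fin n => x i ^ 2) (fun _ _ => sq_nonneg _) (by simpa using h)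

theorem hasFDerivAt_sqNormFirst (j : ℕ) (x : EuclideanSpace ℝ (Fin n)) :
    HasFDerivAt (sqNormFirst j) ((2 : ℝ) • innerSL ℝ (headProj j x)) x := by
  have h := ((headProj j).hasFDerivAt (x := x)).norm_sq
  simp only [norm_headProj_sq] at h
  refine h.congr_fderiv ?_
  ext y
  simp [inner_headProj_left, two_smul]

theorem contDiff_sqNormFirst (j : ℕ) :
    ContDiff ℝ ∞ (sqNormFirst j : EuclideanSpace ℝ (Fin n) → ℝ) := by
  have : (sqNormFirst j : EuclideanSpace ℝ (Fin n) → ℝ) = fun x => ‖headProj j x‖ ^ 2 := by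
    ext x; rw [norm_headProj_sq]
  rw [this]
  exact ((headProj j).contDiff).norm_sq ℝ

variable [NeZero n]

theorem isOpen_halfSpace : IsOpen (halfSpace n) :=
  isOpen_lt continuous_const (by fun_prop)

theorem sq_zero_le_sqNormFirst {j : ℕ} (h : 1 ≤ j) (x : EuclideanSpace ℝ (Fin n)) :
    x 0 ^ 2 ≤ sqNormFirst j x :=
  sq_le_sqNormFirst 0 (by rw [Fin.val_zero]; omega) x

theorem sqNormFirst_pos {j : ℕ} (h : 1 ≤ j) {x : EuclideanSpace ℝ (Fin n)}
    (hx : x ∈ halfSpace n) : 0 < sqNormFirst j x :=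
  (pow_pos hx 2).trans_le (sq_zero_le_sqNormFirst h x)

end Geometry

/-! ### Algebra of the logarithmic gradient. -/

/-- The logarithmic gradient of `∏ⱼ |X_{j+1}|^(C (j+1) - C j)`. -/
noncomputable def radialField {n : ℕ} (C : ℕ → ℝ) (x : EuclideanSpace ℝ (Fin n)) :
    EuclideanSpace ℝ (Fin n) :=
  ∑ j ∈ Finset.range n, ((C (j + 1) - C j) / sqNormFirst (j + 1) x) • headProj (j + 1) x

section RadialField

theorem radialField_add {n : ℕ} (A B : ℕ → ℝ) (x : EuclideanSpace ℝ (Fin n)) :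
    radialField (A + B) x = radialField A x + radialField B x := by
  simp only [radialField, ← Finset.sum_add_distrib, ← add_smul, ← add_div, Pi.add_apply]
  refine Finset.sum_congr rfl fun j _ => ?_
  congr 2
  ring

variable {n : ℕ} [NeZero n]

theorem inner_sum_headProj (C : ℕ → ℝ) {x : EuclideanSpace ℝ (Fin n)} (hx : x ∈ halfSpace n)
    {m l : ℕ} (h : m ≤ l) :
    inner ℝ (∑ j ∈ Finset.range m, ((C (j + 1) - C j) / sqNormFirst (j + 1) x) •
      headProj (j + 1) x) (headProj l x) = C m - C 0 := by
  rw [sum_inner, ← Finset.sum_range_sub]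
  refine Finset.sum_congr rfl fun j hj => ?_
  rw [Finset.mem_range] at hj
  rw [real_inner_smul_left, inner_headProj_headProj (by omega),
    div_mul_cancel₀ _ (sqNormFirst_pos (by omega) hx).ne']

/-- Adding the term of index m to the partial sum contributes a cross term 2 (C (m+1) - C m) C m and
a square (C (m+1) - C m)², both over |X_{m+1}|²; together they are a difference of squares. -/
theorem norm_radialField_sq {C : ℕ → ℝ} (h0 : C 0 = 0) {x : EuclideanSpace ℝ (Fin n)}
    (hx : x ∈ halfSpace n) :
    ‖radialField C x‖ ^ 2 =
      ∑ j ∈ Finset.range n, (C (j + 1) ^ 2 - C j ^ 2) / sqNormFirst (j + 1) x := by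
  suffices ∀ m : ℕ, ‖∑ j ∈ Finset.range m, ((C (j + 1) - C j) / sqNormFirst (j + 1) x) •
      headProj (j + 1) x‖ ^ 2 =
      ∑ j ∈ Finset.range m, (C (j + 1) ^ 2 - C j ^ 2) / sqNormFirst (j + 1) x from this n
  intro m
  induction m with
  | zero => simp
  | succ m ih =>
    have hs := (sqNormFirst_pos (j := m + 1) (by omega) hx).ne'
    rw [Finset.sum_range_succ, norm_add_sq_real, ih, real_inner_smul_right,
      inner_sum_headProj C hx (by omega), norm_smul, mul_pow, norm_headProj_sq,
      Finset.sum_range_succ, Real.norm_eq_abs, sq_abs, h0]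
    field_simp
    ring

/-- Terms of index at most j telescope to C j; each later one meets X_j in |X_j|², which the
division cancels. -/
theorem inner_radialField_headProj {C : ℕ → ℝ} (h0 : C 0 = 0) {x : EuclideanSpace ℝ (Fin n)}
    (hx : x ∈ halfSpace n) {j : ℕ} (hj : 1 ≤ j) (hjn : j ≤ n) :
    inner ℝ (radialField C x) (headProj j x) / sqNormFirst j x =
      C j / sqNormFirst j x +
        ∑ i ∈ Finset.Ico j n, (C (i + 1) - C i) / sqNormFirst (i + 1) x := by
  unfold radialField
  rw [← Finset.sum_range_add_sum_Ico _ hjn, inner_add_left, inner_sum_headProj C hx le_rfl, h0,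
    sub_zero, add_div, sum_inner, Finset.sum_div]
  congr 1
  refine Finset.sum_congr rfl fun i hi => ?_
  rw [Finset.mem_Ico] at hi
  rw [real_inner_smul_left, real_inner_comm, inner_headProj_headProj (by omega), mul_div_assoc,
    div_self (sqNormFirst_pos hj hx).ne', mul_one]

/-- Euler's relation for a function homogeneous of degree C n. -/
theorem inner_radialField_self {C : ℕ → ℝ} (h0 : C 0 = 0) {x : EuclideanSpace ℝ (Fin n)}
    (hx : x ∈ halfSpace n) : inner ℝ (radialField C x) x = C n := by
  have := inner_sum_headProj C hx (le_refl n)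
  rwa [headProj_of_le le_rfl, h0, sub_zero] at this

theorem contDiffAt_inv_sqNormFirst {j : ℕ} (hj : 1 ≤ j) {x : EuclideanSpace ℝ (Fin n)}
    (hx : x ∈ halfSpace n) : ContDiffAt ℝ ∞ (fun y => (sqNormFirst j y)⁻¹) x :=
  (contDiff_sqNormFirst j).contDiffAt.inv (sqNormFirst_pos hj hx).ne'

theorem continuousOn_radialField (C : ℕ → ℝ) :
    ContinuousOn (radialField C : EuclideanSpace ℝ (Fin n) → _) (halfSpace n) := by
  refine continuousOn_finsetSum _ fun j _ => ?_
  refine (continuousOn_const.div (contDiff_sqNormFirst _).continuous.continuousOn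
    fun x hx => (sqNormFirst_pos (by omega) hx).ne').smul (headProj _).continuous.continuousOn

theorem norm_radialField_le (C : ℕ → ℝ) {x : EuclideanSpace ℝ (Fin n)} (hx : x ∈ halfSpace n) :
    ‖radialField C x‖ ≤ (∑ j ∈ Finset.range n, |C (j + 1) - C j|) / x 0 := by
  rw [Finset.sum_div]
  refine (norm_sum_le _ _).trans (Finset.sum_le_sum fun j _ => ?_)
  have hx0 : 0 < x 0 := hx
  have hs := sqNormFirst_pos (j := j + 1) (by omega) hx
  have h1 := norm_headProj_sq (j + 1) x
  have h2 := sq_zero_le_sqNormFirst (j := j + 1) (by omega) x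
  have h3 : x 0 ≤ ‖headProj (j + 1) x‖ := by
    rw [← h1] at h2; exact le_of_sq_le_sq h2 (norm_nonneg _)
  rw [norm_smul, Real.norm_eq_abs, abs_div, abs_of_pos hs, ← h1, div_mul_eq_mul_div,
    div_le_div_iff₀ (h1 ▸ hs) hx0]
  nlinarith [mul_le_mul_of_nonneg_left h3
    (mul_nonneg (abs_nonneg (C (j + 1) - C j)) (norm_nonneg (headProj (j + 1) x)))]

end RadialField

/-! ### Test functions and integration by parts. -/

section TestFunction

variable {n : ℕ} {u : EuclideanSpace ℝ (Fin n) → ℝ}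

theorem gradient_eq_zero_of_notMem_tsupport {x : EuclideanSpace ℝ (Fin n)} (hx : x ∉ tsupport u) :
    gradient u x = 0 := by
  have : fderiv ℝ u x = 0 := by
    rw [(notMem_tsupport_iff_eventuallyEq.mp hx).fderiv_eq]
    simp
  simp [gradient, this]

variable [NeZero n]

theorem IsTestFunction.integrableOn (hu : IsTestFunction n u) {f : EuclideanSpace ℝ (Fin n) → ℝ}
    (hf : ContinuousOn f (halfSpace n)) (h0 : ∀ x ∉ tsupport u, f x = 0) :
    IntegrableOn f (halfSpace n) :=
  ((hf.mono hu.support_subset).integrableOn_compact hu.compact_support).of_forall_sdiff_eq_zero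
    isOpen_halfSpace.measurableSet fun x hx => h0 x hx.2

theorem IsTestFunction.mul (hu : IsTestFunction n u) {h : EuclideanSpace ℝ (Fin n) → ℝ}
    (hh : ∀ x ∈ halfSpace n, ContDiffAt ℝ ∞ h x) : IsTestFunction n (fun x => u x * h x) where
  smooth := by
    rw [contDiff_iff_contDiffAt]
    intro x
    by_cases hx : x ∈ tsupport u
    · exact hu.smooth.contDiffAt.mul (hh x (hu.support_subset hx))
    · have h0 : (fun x => u x * h x) =ᶠ[nhds x] fun _ => 0 := by
        filter_upwards [notMem_tsupport_iff_eventuallyEq.mp hx] with y hy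
        simp [hy]
      exact contDiffAt_const.congr_of_eventuallyEq h0
  compact_support := hu.compact_support.mul_right
  support_subset := (tsupport_mul_subset_left).trans hu.support_subset

theorem IsTestFunction.differentiable (hu : IsTestFunction n u) : Differentiable ℝ u :=
  hu.smooth.differentiable (by simp)

theorem IsTestFunction.continuous_gradient (hu : IsTestFunction n u) : Continuous (gradient u) :=
  (InnerProductSpace.toDual ℝ _).symm.continuous.comp (hu.smooth.continuous_fderiv (by simp))

theorem IsTestFunction.integrableOn_fderiv (hu : IsTestFunction n u)
    (v : EuclideanSpace ℝ (Fin n)) : IntegrableOn (fun x => fderiv ℝ u x v) (halfSpace n) := by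
  simp only [← inner_gradient_left]
  exact hu.integrableOn (hu.continuous_gradient.inner continuous_const).continuousOn
    fun x hx => by simp [gradient_eq_zero_of_notMem_tsupport hx]

theorem IsTestFunction.integral_fderiv (hu : IsTestFunction n u)
    (v : EuclideanSpace ℝ (Fin n)) : ∫ x in halfSpace n, fderiv ℝ u x v = 0 := by
  have hz : ∀ x, x ∉ halfSpace n → fderiv ℝ u x v = 0 := fun x hx => by
    simp [← inner_gradient_left, gradient_eq_zero_of_notMem_tsupport (fun h => hx (hu.support_subset h))]
  rw [setIntegral_eq_integral_of_forall_compl_eq_zero hz]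
  have h1 : Integrable (fun x => fderiv ℝ u x v) :=
    (integrableOn_iff_integrable_of_support_subset
      (fun x hx => by by_contra h; exact hx (hz x h))).mp (hu.integrableOn_fderiv v)
  have := integral_mul_fderiv_eq_neg_fderiv_mul_of_integrable (𝕜 := ℝ) (μ := volume)
    (f := fun _ : EuclideanSpace ℝ (Fin n) => (1 : ℝ)) (g := u) (v := v) (by simp)
    (by simpa using h1)
    (by simpa using hu.smooth.continuous.integrable_of_hasCompactSupport hu.compact_support)
    (fun _ _ => differentiableAt_const _) fun x _ => hu.differentiable x
  simpa using this

/-- Integration by parts against the vector field `ρ(x) X_j`. -/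
theorem IsTestFunction.integral_headProj (hu : IsTestFunction n u) {j : ℕ} (hj : j ≤ n)
    {ρ : EuclideanSpace ℝ (Fin n) → ℝ} (hρ : ∀ x ∈ halfSpace n, ContDiffAt ℝ ∞ ρ x) :
    ∫ x in halfSpace n, (2 * (u x * inner ℝ (gradient u x) (headProj j x)) * ρ x +
      u x ^ 2 * (j * ρ x + fderiv ℝ ρ x (headProj j x))) = 0 := by
  -- The divergence theorem is applied to u² ρ X_j coordinate by coordinate. One factor u is split
  -- off because ρ is smooth only in the half-space.
  have htest : ∀ i : Fin n, IsTestFunction n (fun x => u x * (u x * x i * ρ x)) := fun i =>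
    hu.mul fun x hx =>
      (hu.smooth.contDiffAt.mul (by fun_prop)).mul (hρ x hx)
  have hsum := integral_finsetSum (μ := volume.restrict (halfSpace n))
    (Finset.univ.filter fun i : Fin n => (i : ℕ) < j)
    (f := fun i x => fderiv ℝ (fun x => u x * (u x * x i * ρ x)) x (EuclideanSpace.single i 1))
    fun i _ => (htest i).integrableOn_fderiv _
  simp only [fun i => (htest i).integral_fderiv (EuclideanSpace.single i 1),
    Finset.sum_const_zero] at hsum
  rw [← hsum]
  refine setIntegral_congr_fun isOpen_halfSpace.measurableSet fun x hx => ?_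
  have hd : ∀ i : Fin n, fderiv ℝ (fun x => u x * (u x * x i * ρ x)) x
      (EuclideanSpace.single i 1) =
      (2 * u x * ρ x) * (x i * fderiv ℝ u x (EuclideanSpace.single i 1)) + u x ^ 2 * ρ x +
        u x ^ 2 * (x i * fderiv ℝ ρ x (EuclideanSpace.single i 1)) := by
    intro i
    have h1 := (hu.differentiable x).hasFDerivAt
    have h2 := ((hρ x hx).differentiableAt (by simp)).hasFDerivAt
    have h3 : HasFDerivAt (fun x : EuclideanSpace ℝ (Fin n) => x i)
        (EuclideanSpace.proj i : EuclideanSpace ℝ (Fin n) →L[ℝ] ℝ) x :=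
      (EuclideanSpace.proj i : EuclideanSpace ℝ (Fin n) →L[ℝ] ℝ).hasFDerivAt
    rw [(h1.fun_mul ((h1.fun_mul h3).fun_mul h2)).fderiv]
    simp
    ring
  have hP : ∀ L : EuclideanSpace ℝ (Fin n) →L[ℝ] ℝ, L (headProj j x) =
      ∑ i ∈ Finset.univ.filter fun i : Fin n => (i : ℕ) < j,
        x i * L (EuclideanSpace.single i 1) := by
    intro L
    have : headProj j x = ∑ i ∈ Finset.univ.filter fun i : Fin n => (i : ℕ) < j,
        x i • EuclideanSpace.single i (1 : ℝ) := by
      ext l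
      simp [Finset.sum_apply, Finset.sum_filter]
      rw [Finset.sum_eq_single l (fun c _ hc => by split_ifs <;> simp [hc.symm]) (by simp)]
      split_ifs <;> simp
    rw [this, map_sum]
    simp
  have hcard : (Finset.univ.filter fun i : Fin n => (i : ℕ) < j).card = j := by
    rw [Fin.card_filter_val_lt]; omega
  simp only [hd, inner_gradient_left, hP, Finset.sum_add_distrib, ← Finset.mul_sum,
    Finset.sum_const, hcard, nsmul_eq_mul]
  ring

end TestFunction

/-! ### Completing the square in the Dirichlet integral. -/

section Energy

variable {n : ℕ} [NeZero n] {u : EuclideanSpace ℝ (Fin n) → ℝ}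

theorem fderiv_inv_sqNormFirst {j : ℕ} (hj : 1 ≤ j) {x : EuclideanSpace ℝ (Fin n)}
    (hx : x ∈ halfSpace n) :
    fderiv ℝ (fun y => (sqNormFirst j y)⁻¹) x (headProj j x) = -2 / sqNormFirst j x := by
  have hs := (sqNormFirst_pos hj hx).ne'
  have h := (hasDerivAt_inv hs).comp_hasFDerivAt x (hasFDerivAt_sqNormFirst j x)
  change fderiv ℝ (Inv.inv ∘ sqNormFirst j) x (headProj j x) = _
  rw [h.fderiv]
  simp [norm_headProj_sq]
  field_simp

/-- The field X_j/|X_j|² has divergence (j - 2)/|X_j|². -/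
theorem IsTestFunction.integral_headProj_div (hu : IsTestFunction n u) {j : ℕ} (hj : 1 ≤ j)
    (hjn : j ≤ n) :
    ∫ x in halfSpace n, (2 * (u x * inner ℝ (gradient u x) (headProj j x)) +
      (j - 2) * u x ^ 2) / sqNormFirst j x = 0 := by
  rw [← hu.integral_headProj hjn fun x hx => contDiffAt_inv_sqNormFirst hj hx]
  refine setIntegral_congr_fun isOpen_halfSpace.measurableSet fun x hx => ?_
  have hs := (sqNormFirst_pos hj hx).ne'
  simp only [fderiv_inv_sqNormFirst hj hx]
  field_simp
  ring

theorem IsTestFunction.integral_inner_self (hu : IsTestFunction n u) :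
    ∫ x in halfSpace n, (2 * (u x * inner ℝ (gradient u x) x) + n * u x ^ 2) = 0 := by
  rw [← hu.integral_headProj (le_refl n) (ρ := fun _ => 1) fun x hx => contDiffAt_const]
  refine setIntegral_congr_fun isOpen_halfSpace.measurableSet fun x hx => ?_
  simp [headProj_of_le le_rfl]
  ring

theorem IsTestFunction.integrableOn_hardy (hu : IsTestFunction n u) {j : ℕ} (hj : 1 ≤ j) :
    IntegrableOn (fun x => |u x| ^ 2 / sqNormFirst j x) (halfSpace n) :=
  hu.integrableOn ((hu.smooth.continuous.abs.pow 2).continuousOn.div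
    (contDiff_sqNormFirst j).continuous.continuousOn fun _ hx => (sqNormFirst_pos hj hx).ne')
    fun x hx => by simp [image_eq_zero_of_notMem_tsupport hx]

/-- The cross term -2u ∇u·F integrates to (C (j+1) - C j)(j - 1) against 1/|X_{j+1}|², and |F|² adds
C (j+1)² - C j²; the common factor comes out. -/
theorem IsTestFunction.integral_norm_gradient_sub (hu : IsTestFunction n u) {C : ℕ → ℝ}
    (h0 : C 0 = 0) :
    ∫ x in halfSpace n, ‖gradient u x - u x • radialField C x‖ ^ 2 =
      dirichletIntegral n u + ∑ j ∈ Finset.range n,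
        (C (j + 1) - C j) * (j - 1 + C (j + 1) + C j) * hardyIntegral n (j + 1) u := by
  have hcu := hu.smooth.continuous
  have hI1 : IntegrableOn (fun x => ‖gradient u x‖ ^ 2) (halfSpace n) :=
    hu.integrableOn (hu.continuous_gradient.norm.pow 2).continuousOn
      fun x hx => by simp [gradient_eq_zero_of_notMem_tsupport hx]
  have hI2 : ∀ j ∈ Finset.range n, IntegrableOn (fun x => (C (j + 1) - C j) *
      ((2 * (u x * inner ℝ (gradient u x) (headProj (j + 1) x)) +
        (((j + 1 : ℕ) : ℝ) - 2) * u x ^ 2) / sqNormFirst (j + 1) x)) (halfSpace n) := fun j _ => by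
    refine Integrable.const_mul (hu.integrableOn (ContinuousOn.div ?_
      (contDiff_sqNormFirst _).continuous.continuousOn
      fun _ hx => (sqNormFirst_pos (by omega) hx).ne')
      fun x hx => by simp [image_eq_zero_of_notMem_tsupport hx]) _
    have := hu.continuous_gradient.inner (𝕜 := ℝ)
      (headProj (j + 1) : EuclideanSpace ℝ (Fin n) →L[ℝ] _).continuous
    exact (by fun_prop : Continuous _).continuousOn
  have hI3 : ∀ j ∈ Finset.range n, IntegrableOn (fun x =>
      ((C (j + 1) - C j) * (j - 1 + C (j + 1) + C j)) * (|u x| ^ 2 / sqNormFirst (j + 1) x))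
      (halfSpace n) := fun j _ => (hu.integrableOn_hardy (by omega)).const_mul _
  have key : ∀ x ∈ halfSpace n, ‖gradient u x - u x • radialField C x‖ ^ 2 =
      (‖gradient u x‖ ^ 2 - ∑ j ∈ Finset.range n, (C (j + 1) - C j) *
      ((2 * (u x * inner ℝ (gradient u x) (headProj (j + 1) x)) +
        (((j + 1 : ℕ) : ℝ) - 2) * u x ^ 2) / sqNormFirst (j + 1) x)) + ∑ j ∈ Finset.range n,
      ((C (j + 1) - C j) * (j - 1 + C (j + 1) + C j)) * (|u x| ^ 2 / sqNormFirst (j + 1) x) := by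
    intro x hx
    rw [norm_sub_sq_real, norm_smul, mul_pow, norm_radialField_sq h0 hx, radialField,
      real_inner_smul_right, inner_sum, sub_add, sub_add, Real.norm_eq_abs, Finset.mul_sum,
      Finset.mul_sum, Finset.mul_sum, ← Finset.sum_sub_distrib, ← Finset.sum_sub_distrib]
    congr 1
    refine Finset.sum_congr rfl fun j _ => ?_
    have hs := (sqNormFirst_pos (j := j + 1) (by omega) hx).ne'
    rw [real_inner_smul_right, sq_abs]
    push_cast
    field_simp
    ring
  rw [setIntegral_congr_fun isOpen_halfSpace.measurableSet key,
    integral_add (by exact hI1.sub (integrable_finsetSum _ hI2)) (integrable_finsetSum _ hI3),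
    integral_sub hI1 (integrable_finsetSum _ hI2), integral_finsetSum _ hI2,
    integral_finsetSum _ hI3]
  simp only [integral_const_mul]
  rw [Finset.sum_eq_zero (s := Finset.range n) fun j hj => by
    rw [hu.integral_headProj_div (by omega) (by have := Finset.mem_range.mp hj; omega), mul_zero]]
  rw [sub_zero]
  rfl

end Energy

/-! ### The ground state and the lower bound. -/

/-- The degree of homogeneity of `x₁ |X_k|^(-k/2) |X_{k+1}|^(-1/2) ⋯ |X_M|^(-1/2)` in the
coordinates `x₁, …, x_j`, once the factors beyond the `j`-th are dropped. -/
noncomputable def groundDegree (k M j : ℕ) : ℝ :=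
  if j = 0 then 0 else if j < k then 1 else 1 - ((min j M : ℕ) : ℝ) / 2

/-- The Dirichlet integral minus the first Hardy terms, up to the index `M`. -/
noncomputable def hardyDeficit (n : ℕ) [NeZero n] (k M : ℕ)
    (u : EuclideanSpace ℝ (Fin n) → ℝ) : ℝ :=
  dirichletIntegral n u - (k : ℝ) ^ 2 / 4 * hardyIntegral n k u
    - ∑ j ∈ Finset.Icc (k + 1) M, (1 / 4 : ℝ) * hardyIntegral n j u

section Deficit

variable {n : ℕ} [NeZero n] {u : EuclideanSpace ℝ (Fin n) → ℝ} {k M : ℕ}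

theorem groundDegree_zero (k M : ℕ) : groundDegree k M 0 = 0 := by simp [groundDegree]

theorem groundDegree_of_le (hk : 1 ≤ k) {j : ℕ} (hj : k ≤ j) (hM : j ≤ M) :
    groundDegree k M j = 1 - (j : ℝ) / 2 := by
  rw [groundDegree, if_neg (by omega), if_neg (by omega), min_eq_left hM]

theorem groundDegree_of_ge (hk : 1 ≤ k) (hkM : k ≤ M) {j : ℕ} (hj : M ≤ j) :
    groundDegree k M j = 1 - (M : ℝ) / 2 := by
  rw [groundDegree, if_neg (by omega), if_neg (by omega), min_eq_right hj]

theorem groundDegree_of_lt {j : ℕ} (h0 : 1 ≤ j) (hj : j < k) : groundDegree k M j = 1 := by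
  rw [groundDegree, if_neg (by omega), if_pos hj]

/-- Below k the factor is x₁, which is harmonic and costs nothing. At k > 1 the degree drops by k/2,
giving (-k/2)(k/2); each later drop of 1/2, up to M, gives (-1/2)(1/2). -/
theorem groundDegree_coeff (hk : 1 ≤ k) (hkM : k ≤ M) (j : ℕ) :
    (groundDegree k M (j + 1) - groundDegree k M j) *
      (j - 1 + groundDegree k M (j + 1) + groundDegree k M j) =
    (if j + 1 = k then -((k : ℝ) ^ 2 / 4) else 0) +
      if j + 1 ∈ Finset.Icc (k + 1) M then -(1 / 4 : ℝ) else 0 := by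
  simp only [Finset.mem_Icc]
  rcases lt_trichotomy (j + 1) k with h | h | h
  · rw [if_neg (by omega), if_neg (by omega), groundDegree_of_lt (by omega) h]
    rcases Nat.eq_zero_or_pos j with rfl | hj
    · simp [groundDegree_zero]
    · rw [groundDegree_of_lt hj (by omega)]; ring
  · rw [if_pos h, if_neg (by omega), groundDegree_of_le hk h.ge (by omega)]
    subst h
    rcases Nat.eq_zero_or_pos j with rfl | hj
    · simp [groundDegree_zero]; norm_num
    · rw [groundDegree_of_lt hj (by omega)]; push_cast; ring
  · rw [if_neg (by omega)]
    by_cases hM : j + 1 ≤ M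
    · rw [if_pos (by omega), groundDegree_of_le hk h.le hM,
        groundDegree_of_le hk (by omega) (by omega)]
      push_cast; ring
    · rw [if_neg (by omega), groundDegree_of_ge hk hkM (by omega),
        groundDegree_of_ge hk hkM (by omega)]
      ring

theorem IsTestFunction.hardyDeficit_eq (hu : IsTestFunction n u) (hk : 1 ≤ k) (hkM : k ≤ M)
    (hM : M ≤ n) :
    hardyDeficit n k M u =
      ∫ x in halfSpace n, ‖gradient u x - u x • radialField (groundDegree k M) x‖ ^ 2 := by
  rw [hu.integral_norm_gradient_sub (groundDegree_zero k M)]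
  simp only [groundDegree_coeff hk hkM]
  rw [hardyDeficit, sub_sub, sub_eq_add_neg]
  congr 1
  have h1 := Finset.sum_Ico_add' (fun j => ((if j = k then -((k : ℝ) ^ 2 / 4) else 0) +
      if j ∈ Finset.Icc (k + 1) M then -(1 / 4 : ℝ) else 0) * hardyIntegral n j u) 0 n 1
  rw [← Finset.range_eq_Ico] at h1
  rw [h1]
  simp only [add_mul, ite_mul, zero_mul, Finset.sum_add_distrib, neg_add]
  rw [Finset.sum_ite_eq' , if_pos (by simp; omega), ← Finset.sum_filter,
    Finset.filter_mem_eq_inter, Finset.inter_eq_right.mpr, ← Finset.sum_neg_distrib]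
  · simp
  · intro j; simp; omega

theorem IsTestFunction.hardyDeficit_nonneg (hu : IsTestFunction n u) (hk : 1 ≤ k) (hkM : k ≤ M)
    (hM : M ≤ n) : 0 ≤ hardyDeficit n k M u := by
  rw [hu.hardyDeficit_eq hk hkM hM]
  exact integral_nonneg fun _ => by positivity

theorem IsTestFunction.hardyIntegral_pos (hu : IsTestFunction n u) (h0 : u ≠ 0) {j : ℕ}
    (hj : 1 ≤ j) : 0 < hardyIntegral n j u := by
  rw [hardyIntegral, setIntegral_pos_iff_support_of_nonneg_ae]
  · obtain ⟨x, hx⟩ := Function.ne_iff.mp h0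
    refine (hu.smooth.continuous.isOpen_support.measure_pos volume ⟨x, hx⟩).trans_le
      (measure_mono fun y hy => ?_)
    have hy' := hu.support_subset (subset_tsupport u hy)
    refine ⟨?_, hy'⟩
    have := sqNormFirst_pos hj hy'
    have hy0 : u y ≠ 0 := hy
    simp only [Function.mem_support]
    positivity
  · exact Filter.Eventually.of_forall fun x =>
      div_nonneg (by positivity) (sqNormFirst_nonneg j x)
  · exact hu.integrableOn_hardy hj

end Deficit

/-! ### Cutoffs with gradient bounds uniform in N. -/

theorem Real.smoothTransition.deriv_eq_zero {t : ℝ} (ht : t < 0 ∨ 1 < t) :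
    deriv Real.smoothTransition t = 0 := by
  rcases ht with ht | ht
  · have : Real.smoothTransition =ᶠ[nhds t] fun _ => 0 := by
      filter_upwards [gt_mem_nhds ht] with y hy
      exact Real.smoothTransition.zero_of_nonpos hy.le
    rw [this.deriv_eq, deriv_const]
  · have : Real.smoothTransition =ᶠ[nhds t] fun _ => 1 := by
      filter_upwards [lt_mem_nhds ht] with y hy
      exact Real.smoothTransition.one_of_one_le hy.le
    rw [this.deriv_eq, deriv_const]

theorem Real.smoothTransition.exists_deriv_bound :
    ∃ K : ℝ, 0 ≤ K ∧ ∀ t, |deriv Real.smoothTransition t| ≤ K := by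
  have hc : Continuous (deriv Real.smoothTransition) :=
    (Real.smoothTransition.contDiff (n := 1)).continuous_deriv le_rfl
  obtain ⟨K, hK⟩ := (isCompact_Icc (a := (0 : ℝ)) (b := 1)).exists_bound_of_continuousOn
    hc.continuousOn
  refine ⟨K, (norm_nonneg _).trans (hK 0 (by simp)), fun t => ?_⟩
  by_cases ht : t ∈ Set.Icc (0 : ℝ) 1
  · exact hK t ht
  · rw [deriv_eq_zero, abs_zero]
    · exact (norm_nonneg _).trans (hK 0 (by simp))
    · by_contra! h
      exact ht h

/-- A smooth cutoff supported in `{x₁ ≥ 1 / (N + 1)}` and in a ball of radius `2 (N + 1)`. -/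
noncomputable def halfSpaceCutoff (n : ℕ) [NeZero n] (N : ℕ) (x : EuclideanSpace ℝ (Fin n)) : ℝ :=
  Real.smoothTransition ((N + 1) * x 0 - 1) * Real.smoothTransition (2 - ‖x‖ ^ 2 / (N + 1) ^ 2)

section Cutoff

variable {n : ℕ} [NeZero n]

theorem abs_halfSpaceCutoff_le (N : ℕ) (x : EuclideanSpace ℝ (Fin n)) :
    |halfSpaceCutoff n N x| ≤ 1 := by
  rw [halfSpaceCutoff, abs_mul, abs_of_nonneg (Real.smoothTransition.nonneg _),
    abs_of_nonneg (Real.smoothTransition.nonneg _)]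
  exact mul_le_one₀ (Real.smoothTransition.le_one _) (Real.smoothTransition.nonneg _)
    (Real.smoothTransition.le_one _)

theorem isTestFunction_halfSpaceCutoff (N : ℕ) : IsTestFunction n (halfSpaceCutoff n N) := by
  have hN : (0 : ℝ) < N + 1 := by positivity
  have hsub : tsupport (halfSpaceCutoff n N) ⊆
      {x | 1 ≤ (N + 1) * x 0} ∩ Metric.closedBall 0 (2 * (N + 1)) := by
    refine closure_minimal (fun x hx => ?_) (IsClosed.inter
      (isClosed_le continuous_const (by fun_prop)) Metric.isClosed_closedBall)
    obtain ⟨h1, h2⟩ := mul_ne_zero_iff.mp (Function.mem_support.mp hx)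
    rw [Ne, Real.smoothTransition.zero_iff_nonpos, not_le] at h1 h2
    refine ⟨by simp only [Set.mem_ofPred_eq]; linarith, ?_⟩
    rw [mem_closedBall_zero_iff]
    rw [sub_pos, div_lt_iff₀ (by positivity)] at h2
    exact le_of_sq_le_sq (by nlinarith) (by positivity)
  refine ⟨?_, ?_, fun x hx => ?_⟩
  · have h1 : ContDiff ℝ ∞ fun x : EuclideanSpace ℝ (Fin n) => ((N : ℝ) + 1) * x 0 - 1 := by
      fun_prop
    have h2 : ContDiff ℝ ∞ fun x : EuclideanSpace ℝ (Fin n) => 2 - ‖x‖ ^ 2 / ((N : ℝ) + 1) ^ 2 :=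
      contDiff_const.sub ((contDiff_norm_sq ℝ).div_const _)
    exact (Real.smoothTransition.contDiff.comp h1).mul (Real.smoothTransition.contDiff.comp h2)
  · exact (isCompact_closedBall _ _).of_isClosed_subset (isClosed_tsupport _)
      (hsub.trans Set.inter_subset_right)
  · have h1 : 1 ≤ (N + 1) * x 0 := (hsub hx).1
    exact (mul_pos_iff_of_pos_left hN).mp (by linarith)

theorem eventually_halfSpaceCutoff_eq_one {x : EuclideanSpace ℝ (Fin n)} (hx : x ∈ halfSpace n) :
    ∀ᶠ N : ℕ in Filter.atTop, halfSpaceCutoff n N =ᶠ[nhds x] fun _ => 1 := by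
  have hx0 : 0 < x 0 := hx
  filter_upwards [tendsto_natCast_atTop_atTop.eventually_gt_atTop (2 / x 0),
    tendsto_natCast_atTop_atTop.eventually_gt_atTop ‖x‖] with N h1 h2
  rw [div_lt_iff₀ hx0] at h1
  have o1 : ∀ᶠ y : EuclideanSpace ℝ (Fin n) in nhds x, 2 < N * y 0 :=
    (isOpen_lt continuous_const (by fun_prop)).mem_nhds h1
  have o2 : ∀ᶠ y : EuclideanSpace ℝ (Fin n) in nhds x, ‖y‖ < N :=
    (isOpen_lt continuous_norm continuous_const).mem_nhds h2
  have o3 : ∀ᶠ y in nhds x, y ∈ halfSpace n := isOpen_halfSpace.mem_nhds hx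
  filter_upwards [o1, o2, o3] with y h1 h2 h3
  have h3' : 0 < y 0 := h3
  rw [halfSpaceCutoff, Real.smoothTransition.one_of_one_le, Real.smoothTransition.one_of_one_le,
    mul_one]
  · have : ‖y‖ ^ 2 / ((N : ℝ) + 1) ^ 2 ≤ 1 := by
      rw [div_le_one (by positivity)]
      exact pow_le_pow_left₀ (norm_nonneg _) (by linarith) 2
    linarith
  · linarith

/-- The bound does not depend on N, so it can serve as a dominating function. The boundary factor
varies only where (N+1) x₁ ≤ 2, so its slope N+1 is at most 2/x₁; the outer factor has inner
derivative 2|x|/(N+1)² ≤ 2|x|. -/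
theorem exists_norm_gradient_halfSpaceCutoff_le (n : ℕ) [NeZero n] :
    ∃ K : ℝ, 0 ≤ K ∧ ∀ N : ℕ, ∀ x ∈ halfSpace n,
      ‖gradient (halfSpaceCutoff n N) x‖ ≤ K * (1 / x 0 + ‖x‖) := by
  obtain ⟨K, hK0, hK⟩ := Real.smoothTransition.exists_deriv_bound
  refine ⟨2 * K, by positivity, fun N x hx => ?_⟩
  have hx0 : 0 < x 0 := hx
  have hN : (0 : ℝ) < N + 1 := by positivity
  have hd : ∀ t, HasDerivAt Real.smoothTransition (deriv Real.smoothTransition t) t := fun t =>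
    ((Real.smoothTransition.contDiff (n := 1)).differentiable (by simp) t).hasDerivAt
  set t := (N + 1) * x 0 - 1 with ht
  set s := 2 - ‖x‖ ^ 2 / ((N : ℝ) + 1) ^ 2 with hs
  have h1 : HasFDerivAt (fun y : EuclideanSpace ℝ (Fin n) => ((N : ℝ) + 1) * y 0 - 1)
      (((N : ℝ) + 1) • (EuclideanSpace.proj 0 : EuclideanSpace ℝ (Fin n) →L[ℝ] ℝ)) x :=
    (((EuclideanSpace.proj 0 : EuclideanSpace ℝ (Fin n) →L[ℝ] ℝ).hasFDerivAt).const_mul _).sub_const _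
  have h2 : HasFDerivAt (fun y : EuclideanSpace ℝ (Fin n) => 2 - ‖y‖ ^ 2 / ((N : ℝ) + 1) ^ 2)
      (-((((N : ℝ) + 1) ^ 2)⁻¹ • (2 • innerSL ℝ x))) x := by
    simp only [div_eq_inv_mul]
    exact ((hasStrictFDerivAt_norm_sq x).hasFDerivAt.const_mul _).const_sub _
  have h3 := ((hd t).comp_hasFDerivAt x h1).mul ((hd s).comp_hasFDerivAt x h2)
  have hn : ‖gradient (halfSpaceCutoff n N) x‖ = ‖fderiv ℝ (halfSpaceCutoff n N) x‖ := by
    simp [gradient]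
  rw [hn]
  change ‖fderiv ℝ ((Real.smoothTransition ∘ _) * (Real.smoothTransition ∘ _)) x‖ ≤ _
  rw [h3.fderiv]
  have b1 : |deriv Real.smoothTransition t| * (N + 1) ≤ 2 * K / x 0 := by
    rw [le_div_iff₀ hx0, mul_assoc]
    by_cases h : 1 < t
    · rw [Real.smoothTransition.deriv_eq_zero (Or.inr h)]; simp; positivity
    · have : ((N : ℝ) + 1) * x 0 ≤ 2 := by linarith
      have := mul_le_mul (hK t) this (by positivity) hK0
      linarith
  have b2 : |deriv Real.smoothTransition s| * ((((N : ℝ) + 1) ^ 2)⁻¹ * (2 * ‖x‖)) ≤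
      2 * K * ‖x‖ := by
    have : (((N : ℝ) + 1) ^ 2)⁻¹ ≤ 1 := inv_le_one_of_one_le₀ (by nlinarith)
    calc _ ≤ K * (1 * (2 * ‖x‖)) := by gcongr; exact hK s
      _ = _ := by ring
  have c0 : ‖(EuclideanSpace.proj 0 : EuclideanSpace ℝ (Fin n) →L[ℝ] ℝ)‖ ≤ 1 :=
    ContinuousLinearMap.opNorm_le_bound _ zero_le_one fun y => by
      rw [one_mul]; exact PiLp.norm_apply_le y 0
  have e1 : ∀ r : ℝ, |Real.smoothTransition r| ≤ 1 := fun r => by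
    rw [abs_of_nonneg (Real.smoothTransition.nonneg r)]; exact Real.smoothTransition.le_one r
  refine (norm_add_le _ _).trans ?_
  rw [add_comm, mul_add]
  refine add_le_add ?_ ?_
  · rw [norm_smul, norm_smul, norm_smul]
    simp only [Function.comp, Real.norm_eq_abs, abs_of_pos hN]
    calc _ ≤ 1 * (|deriv Real.smoothTransition t| * ((N + 1) * 1)) := by
          gcongr; exact e1 _
      _ ≤ _ := by rw [mul_one, one_mul, mul_one_div]; exact b1
  · rw [norm_smul, norm_smul, norm_neg, norm_smul]
    simp only [Function.comp, Real.norm_eq_abs, abs_inv, abs_pow, abs_of_pos hN]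
    calc _ ≤ 1 * (|deriv Real.smoothTransition s| * ((((N : ℝ) + 1) ^ 2)⁻¹ * (2 * ‖x‖))) := by
          gcongr
          · exact e1 _
          · refine (norm_nsmul_le).trans ?_
            simp
      _ ≤ _ := by rw [one_mul]; exact b2

end Cutoff

/-! ### Gaussian trial functions and their truncations. -/

/-- The Gaussian times `∏ⱼ |X_{j+1}|^(C (j+1) - C j)`, on the half-space. -/
noncomputable def gaussianRadial {n : ℕ} (C : ℕ → ℝ) (x : EuclideanSpace ℝ (Fin n)) : ℝ :=
  Real.exp (∑ j ∈ Finset.range n, (C (j + 1) - C j) / 2 * Real.log (sqNormFirst (j + 1) x)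
    - ‖x‖ ^ 2 / 2)

/-- The function `gaussianRadial C`, cut off near the boundary and at infinity. -/
noncomputable def truncatedRadial {n : ℕ} [NeZero n] (C : ℕ → ℝ) (N : ℕ)
    (x : EuclideanSpace ℝ (Fin n)) : ℝ :=
  halfSpaceCutoff n N x * gaussianRadial C x

/-- A weight dominating `‖∇v‖²` and `v² / x₁²` for `v = gaussianRadial C` and its truncations. -/
noncomputable def gaussianWeight {n : ℕ} [NeZero n] (C : ℕ → ℝ)
    (x : EuclideanSpace ℝ (Fin n)) : ℝ :=
  gaussianRadial C x ^ 2 * ((1 + ‖x‖ ^ 2) / x 0) ^ 2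

section Radial

variable {n : ℕ} [NeZero n] (C : ℕ → ℝ)

theorem gaussianRadial_pos {n : ℕ} (C : ℕ → ℝ) (x : EuclideanSpace ℝ (Fin n)) :
    0 < gaussianRadial C x := Real.exp_pos _

theorem contDiffAt_gaussianRadial {x : EuclideanSpace ℝ (Fin n)} (hx : x ∈ halfSpace n) :
    ContDiffAt ℝ ∞ (gaussianRadial C) x := by
  refine ContDiffAt.exp (ContDiffAt.sub (ContDiffAt.sum fun j _ => contDiffAt_const.mul
    ((contDiff_sqNormFirst _).contDiffAt.log (sqNormFirst_pos (by omega) hx).ne')) ?_)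
  exact ((contDiff_norm_sq ℝ).div_const _).contDiffAt

theorem fderiv_gaussianRadial {x : EuclideanSpace ℝ (Fin n)} (hx : x ∈ halfSpace n) :
    fderiv ℝ (gaussianRadial C) x =
      gaussianRadial C x • innerSL ℝ (radialField C x - x) := by
  have h1 : HasFDerivAt (fun x : EuclideanSpace ℝ (Fin n) =>
      ∑ j ∈ Finset.range n, (C (j + 1) - C j) / 2 * Real.log (sqNormFirst (j + 1) x))
      (∑ j ∈ Finset.range n, ((C (j + 1) - C j) / 2) • ((sqNormFirst (j + 1) x)⁻¹ •
        ((2 : ℝ) • innerSL ℝ (headProj (j + 1) x)))) x :=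
    HasFDerivAt.fun_sum fun j _ =>
      ((hasFDerivAt_sqNormFirst _ x).log (sqNormFirst_pos (by omega) hx).ne').const_mul _
  have h2 : HasFDerivAt (fun x : EuclideanSpace ℝ (Fin n) => ‖x‖ ^ 2 / 2) (innerSL ℝ x) x := by
    simp only [div_eq_inv_mul]
    refine ((hasStrictFDerivAt_norm_sq x).hasFDerivAt.const_mul _).congr_fderiv ?_
    ext y; simp [two_smul]; ring
  change fderiv ℝ (fun x => Real.exp _) x = _
  rw [(h1.fun_sub h2).exp.fderiv]
  ext y
  simp only [radialField, map_sub, map_sum, map_smul, gaussianRadial]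
  congr 3
  refine Finset.sum_congr rfl fun j _ => ?_
  simp only [smul_smul]
  congr 1
  ring

theorem gradient_gaussianRadial {x : EuclideanSpace ℝ (Fin n)} (hx : x ∈ halfSpace n) :
    gradient (gaussianRadial C) x = gaussianRadial C x • (radialField C x - x) := by
  refine HasGradientAt.gradient ?_
  rw [hasGradientAt_iff_hasFDerivAt]
  refine ((contDiffAt_gaussianRadial C hx).differentiableAt (by simp)).hasFDerivAt.congr_fderiv ?_
  rw [fderiv_gaussianRadial C hx]
  ext y
  simp

theorem isTestFunction_truncatedRadial (N : ℕ) :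
    IsTestFunction n (truncatedRadial C N) :=
  (isTestFunction_halfSpaceCutoff N).mul fun _ hx => contDiffAt_gaussianRadial C hx

theorem gradient_truncatedRadial (N : ℕ) {x : EuclideanSpace ℝ (Fin n)} (hx : x ∈ halfSpace n) :
    gradient (truncatedRadial C N) x =
      halfSpaceCutoff n N x • (gaussianRadial C x • (radialField C x - x)) +
        gaussianRadial C x • gradient (halfSpaceCutoff n N) x := by
  have h1 := ((isTestFunction_halfSpaceCutoff (n := n) N).differentiable x).hasFDerivAt
  have h2 := ((contDiffAt_gaussianRadial C hx).differentiableAt (by simp)).hasFDerivAt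
  have h3 := h1.mul h2
  rw [← gradient_gaussianRadial C hx, gradient]
  change (InnerProductSpace.toDual ℝ _).symm
    (fderiv ℝ (halfSpaceCutoff n N * gaussianRadial C) x) = _
  rw [h3.fderiv, map_add, map_smul, map_smul]
  rfl

theorem exists_truncatedRadial_bound :
    ∃ K : ℝ, 0 ≤ K ∧ ∀ N : ℕ, ∀ x ∈ halfSpace n, ‖gradient (truncatedRadial C N) x‖ ^ 2 +
      truncatedRadial C N x ^ 2 * ((1 + ‖x‖ ^ 2) / x 0) ^ 2 ≤ K * gaussianWeight C x := by
  obtain ⟨K, hK0, hK⟩ := exists_norm_gradient_halfSpaceCutoff_le n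
  set S := ∑ j ∈ Finset.range n, |C (j + 1) - C j| with hS
  have hS0 : 0 ≤ S := Finset.sum_nonneg fun _ _ => abs_nonneg _
  refine ⟨(S + 1 + K) ^ 2 + 1, by positivity, fun N x hx => ?_⟩
  have hx0 : 0 < x 0 := hx
  have hv := gaussianRadial_pos C x
  have hxn : x 0 ≤ ‖x‖ := (le_abs_self _).trans (PiLp.norm_apply_le x 0)
  set v := gaussianRadial C x
  set w := (1 + ‖x‖ ^ 2) / x 0 with hw
  have w1 : 1 / x 0 ≤ w := by
    rw [hw]; gcongr; nlinarith [norm_nonneg x]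
  have w2 : 1 / x 0 + ‖x‖ ≤ w := by
    rw [hw, le_div_iff₀ hx0, add_mul, one_div_mul_cancel hx0.ne']
    nlinarith [norm_nonneg x]
  have w3 : ‖x‖ ≤ w := by linarith [one_div_pos.mpr hx0]
  have hw0 : 0 ≤ w := (norm_nonneg _).trans w3
  have hc := abs_halfSpaceCutoff_le N x
  have g1 : ‖gradient (truncatedRadial C N) x‖ ≤ (S + 1 + K) * (v * w) := by
    rw [gradient_truncatedRadial C N hx]
    refine (norm_add_le _ _).trans ?_
    rw [norm_smul, norm_smul, norm_smul, Real.norm_eq_abs, Real.norm_eq_abs, abs_of_pos hv]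
    have f1 : ‖radialField C x - x‖ ≤ (S + 1) * w := by
      refine (norm_sub_le _ _).trans ?_
      have := norm_radialField_le C hx
      rw [← hS, ← mul_one_div] at this
      have := mul_le_mul_of_nonneg_left w1 hS0
      linarith
    have f2 : ‖gradient (halfSpaceCutoff n N) x‖ ≤ K * w :=
      (hK N x hx).trans (mul_le_mul_of_nonneg_left w2 hK0)
    calc _ ≤ 1 * (v * ((S + 1) * w)) + v * (K * w) := by gcongr
      _ = _ := by ring
  have g2 : ‖gradient (truncatedRadial C N) x‖ ^ 2 ≤ (S + 1 + K) ^ 2 * (v * w) ^ 2 := by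
    rw [← mul_pow]; exact pow_le_pow_left₀ (norm_nonneg _) g1 2
  have g3 : truncatedRadial C N x ^ 2 ≤ v ^ 2 := by
    rw [truncatedRadial, mul_pow]
    have : halfSpaceCutoff n N x ^ 2 ≤ 1 := (sq_le_one_iff_abs_le_one _).mpr hc
    nlinarith [sq_nonneg v]
  have g4 := mul_le_mul_of_nonneg_right g3 (sq_nonneg w)
  rw [gaussianWeight]
  linarith [mul_pow v w 2]

/-- Functionals controlled by `gaussianWeight` pass to the limit along the truncations. -/
theorem tendsto_integral_truncatedRadial
    (hW : IntegrableOn (gaussianWeight C) (halfSpace n))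
    {Ψ : EuclideanSpace ℝ (Fin n) → ℝ → EuclideanSpace ℝ (Fin n) → ℝ}
    (hΨ : ∀ f : EuclideanSpace ℝ (Fin n) → ℝ, ∀ p : EuclideanSpace ℝ (Fin n) → _,
      ContinuousOn f (halfSpace n) → ContinuousOn p (halfSpace n) →
        ContinuousOn (fun x => Ψ x (f x) (p x)) (halfSpace n))
    {K : ℝ} (hK : 0 ≤ K) (hbound : ∀ x ∈ halfSpace n, ∀ a p,
      |Ψ x a p| ≤ K * (‖p‖ ^ 2 + a ^ 2 * ((1 + ‖x‖ ^ 2) / x 0) ^ 2)) :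
    IntegrableOn (fun x => Ψ x (gaussianRadial C x) (gaussianRadial C x • (radialField C x - x)))
      (halfSpace n) ∧
    Filter.Tendsto (fun N => ∫ x in halfSpace n,
      Ψ x (truncatedRadial C N x) (gradient (truncatedRadial C N) x)) Filter.atTop
      (nhds (∫ x in halfSpace n,
        Ψ x (gaussianRadial C x) (gaussianRadial C x • (radialField C x - x)))) := by
  obtain ⟨K', hK'0, hK'⟩ := exists_truncatedRadial_bound (n := n) C
  have hm : MeasurableSet (halfSpace n) := isOpen_halfSpace.measurableSet
  have hlim : ∀ x ∈ halfSpace n, ∀ᶠ N in Filter.atTop,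
      Ψ x (truncatedRadial C N x) (gradient (truncatedRadial C N) x) =
        Ψ x (gaussianRadial C x) (gaussianRadial C x • (radialField C x - x)) := by
    intro x hx
    filter_upwards [eventually_halfSpaceCutoff_eq_one hx] with N hN
    have he : truncatedRadial C N =ᶠ[nhds x] gaussianRadial C := by
      filter_upwards [hN] with y hy
      rw [truncatedRadial, hy, one_mul]
    rw [he.eq_of_nhds, he.gradient_eq, gradient_gaussianRadial C hx]
  have hb : ∀ N, ∀ x ∈ halfSpace n,
      |Ψ x (truncatedRadial C N x) (gradient (truncatedRadial C N) x)| ≤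
        K * (K' * gaussianWeight C x) := fun N x hx =>
    (hbound x hx _ _).trans (mul_le_mul_of_nonneg_left (hK' N x hx) hK)
  have hB : IntegrableOn (fun x => K * (K' * gaussianWeight C x)) (halfSpace n) :=
    (hW.const_mul K').const_mul K
  have hcg : ContinuousOn (gaussianRadial C) (halfSpace n) := fun x hx =>
    (contDiffAt_gaussianRadial C hx).continuousAt.continuousWithinAt
  constructor
  · refine hB.mono' ((hΨ _ _ hcg (hcg.smul ((continuousOn_radialField C).sub
      continuousOn_id))).aestronglyMeasurable hm) ?_
    filter_upwards [ae_restrict_mem hm] with x hx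
    -- At each point the sequence is eventually constant, so the limit inherits the uniform bound.
    obtain ⟨N, hN⟩ := (hlim x hx).exists
    rw [← hN]
    exact hb N x hx
  · refine tendsto_integral_of_dominated_convergence _ (fun N => ?_) hB (fun N => ?_) ?_
    · have hu := isTestFunction_truncatedRadial (n := n) C N
      exact (hΨ _ _ hu.smooth.continuous.continuousOn
        hu.continuous_gradient.continuousOn).aestronglyMeasurable hm
    · filter_upwards [ae_restrict_mem hm] with x hx
      exact hb N x hx
    · filter_upwards [ae_restrict_mem hm] with x hx
      exact tendsto_const_nhds.congr' ((hlim x hx).mono fun N hN => hN.symm)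

end Radial

/-! ### Integral identities for the Gaussian trial functions. -/

section Limit

theorem abs_mul_inner_le {n : ℕ} {a w : ℝ} {p q : EuclideanSpace ℝ (Fin n)} (h : ‖q‖ ≤ w) :
    |2 * (a * inner ℝ p q)| ≤ ‖p‖ ^ 2 + a ^ 2 * w ^ 2 := by
  have h1 : |inner ℝ p q| ≤ ‖p‖ * w :=
    (abs_real_inner_le_norm p q).trans (mul_le_mul_of_nonneg_left h (norm_nonneg _))
  rw [abs_mul, abs_mul, abs_two]
  have h2 := mul_le_mul_of_nonneg_left h1 (abs_nonneg a)
  nlinarith [sq_nonneg (‖p‖ - |a| * w), sq_abs a]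

variable {n : ℕ} [NeZero n] {C : ℕ → ℝ}

theorem one_div_le_weight {x : EuclideanSpace ℝ (Fin n)} (hx : x ∈ halfSpace n) :
    1 / x 0 ≤ (1 + ‖x‖ ^ 2) / x 0 := by
  have hx0 : 0 < x 0 := hx
  gcongr
  nlinarith [norm_nonneg x]

theorem one_add_norm_le_weight {x : EuclideanSpace ℝ (Fin n)} (hx : x ∈ halfSpace n) :
    max 1 ‖x‖ ≤ (1 + ‖x‖ ^ 2) / x 0 := by
  have hx0 : 0 < x 0 := hx
  have hxn : x 0 ≤ ‖x‖ := (le_abs_self _).trans (PiLp.norm_apply_le x 0)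
  rw [le_div_iff₀ hx0]
  rcases max_cases 1 ‖x‖ with h | h <;> rw [h.1] <;> nlinarith [sq_nonneg (‖x‖ - 1)]

theorem inv_sqNormFirst_le_weight {j : ℕ} (hj : 1 ≤ j) {x : EuclideanSpace ℝ (Fin n)}
    (hx : x ∈ halfSpace n) : (sqNormFirst j x)⁻¹ ≤ ((1 + ‖x‖ ^ 2) / x 0) ^ 2 := by
  have hx0 : 0 < x 0 := hx
  calc (sqNormFirst j x)⁻¹ ≤ (x 0 ^ 2)⁻¹ :=
        inv_anti₀ (by positivity) (sq_zero_le_sqNormFirst hj x)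
    _ = (1 / x 0) ^ 2 := by simp
    _ ≤ _ := pow_le_pow_left₀ (by positivity) (one_div_le_weight hx) 2

theorem tendsto_hardyIntegral_truncatedRadial
    (hW : IntegrableOn (gaussianWeight C) (halfSpace n)) {j : ℕ} (hj : 1 ≤ j) :
    IntegrableOn (fun x => |gaussianRadial C x| ^ 2 / sqNormFirst j x) (halfSpace n) ∧
    Filter.Tendsto (fun N => hardyIntegral n j (truncatedRadial C N)) Filter.atTop
      (nhds (hardyIntegral n j (gaussianRadial C))) := by
  refine tendsto_integral_truncatedRadial (n := n) C hW
    (Ψ := fun x a p => |a| ^ 2 / sqNormFirst j x) (fun f p hf hp => ?_) zero_le_one ?_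
  · exact (hf.abs.pow 2).div (contDiff_sqNormFirst j).continuous.continuousOn
      fun _ hx => (sqNormFirst_pos hj hx).ne'
  · intro x hx a p
    have := mul_le_mul_of_nonneg_left (inv_sqNormFirst_le_weight hj hx) (sq_nonneg a)
    rw [sq_abs, abs_of_nonneg (div_nonneg (sq_nonneg _) (sqNormFirst_nonneg _ _)), div_eq_mul_inv]
    nlinarith [sq_nonneg ‖p‖]

theorem integrableOn_gaussianRadial_sq
    (hW : IntegrableOn (gaussianWeight C) (halfSpace n)) :
    IntegrableOn (fun x => gaussianRadial C x ^ 2) (halfSpace n) := by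
  refine (tendsto_integral_truncatedRadial (n := n) C hW
    (Ψ := fun x a p => a ^ 2) (fun f p hf hp => hf.pow 2) zero_le_one ?_).1
  intro x hx a p
  have h1 : (1 : ℝ) ≤ ((1 + ‖x‖ ^ 2) / x 0) ^ 2 :=
    one_le_pow₀ ((le_max_left _ _).trans (one_add_norm_le_weight hx))
  rw [abs_of_nonneg (sq_nonneg a)]
  nlinarith [sq_nonneg ‖p‖, mul_le_mul_of_nonneg_left h1 (sq_nonneg a)]

theorem integrableOn_gaussianRadial_sq_mul_norm_sq
    (hW : IntegrableOn (gaussianWeight C) (halfSpace n)) :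
    IntegrableOn (fun x => gaussianRadial C x ^ 2 * ‖x‖ ^ 2) (halfSpace n) := by
  refine (tendsto_integral_truncatedRadial (n := n) C hW
    (Ψ := fun x a p => a ^ 2 * ‖x‖ ^ 2)
    (fun f p hf hp => (hf.pow 2).mul (by fun_prop)) zero_le_one ?_).1
  intro x hx a p
  have h1 : ‖x‖ ^ 2 ≤ ((1 + ‖x‖ ^ 2) / x 0) ^ 2 :=
    pow_le_pow_left₀ (norm_nonneg _) ((le_max_right _ _).trans (one_add_norm_le_weight hx)) 2
  rw [abs_of_nonneg (by positivity)]
  nlinarith [sq_nonneg ‖p‖, mul_le_mul_of_nonneg_left h1 (sq_nonneg a)]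

theorem hardyIntegral_gaussianRadial_pos
    (hW : IntegrableOn (gaussianWeight C) (halfSpace n)) {j : ℕ} (hj : 1 ≤ j) :
    0 < hardyIntegral n j (gaussianRadial C) := by
  rw [hardyIntegral, setIntegral_pos_iff_support_of_nonneg_ae]
  · have hne : (halfSpace n).Nonempty :=
      ⟨EuclideanSpace.single 0 1, by simp [halfSpace]⟩
    refine (isOpen_halfSpace.measure_pos volume hne).trans_le
      (measure_mono fun y hy => ⟨?_, hy⟩)
    have h1 := sqNormFirst_pos hj hy
    have h2 := gaussianRadial_pos C y
    simp only [Function.mem_support]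
    positivity
  · exact Filter.Eventually.of_forall fun x =>
      div_nonneg (by positivity) (sqNormFirst_nonneg j x)
  · exact (tendsto_hardyIntegral_truncatedRadial hW hj).1

/-- Integration by parts against X_j/|X_j|², passed to the limit. The Gaussian contributes -x to the
logarithmic gradient, and x·X_j = |X_j|² produces the right-hand side. -/
theorem integral_gaussianRadial_headProj (h0 : C 0 = 0)
    (hW : IntegrableOn (gaussianWeight C) (halfSpace n)) {j : ℕ} (hj : 1 ≤ j) (hjn : j ≤ n) :
    (j - 2 + 2 * C j) * hardyIntegral n j (gaussianRadial C) +
      2 * ∑ i ∈ Finset.Ico j n, (C (i + 1) - C i) * hardyIntegral n (i + 1) (gaussianRadial C) =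
    2 * ∫ x in halfSpace n, gaussianRadial C x ^ 2 := by
  have hlim := (tendsto_integral_truncatedRadial (n := n) C hW
    (Ψ := fun x a p => (2 * (a * inner ℝ p (headProj j x)) + (j - 2) * a ^ 2) / sqNormFirst j x)
    (fun f p hf hp => ?_) (K := 1 + |(j : ℝ) - 2|) (by positivity) ?_).2
  rotate_left
  · refine ContinuousOn.div ?_ (contDiff_sqNormFirst j).continuous.continuousOn
      fun _ hx => (sqNormFirst_pos hj hx).ne'
    exact (continuousOn_const.mul (hf.mul (hp.inner (headProj j).continuous.continuousOn))).add
      (continuousOn_const.mul (hf.pow 2))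
  · intro x hx a p
    set w := (1 + ‖x‖ ^ 2) / x 0
    have hs := sqNormFirst_pos hj hx
    have h1 : ‖(sqNormFirst j x)⁻¹ • headProj j x‖ ≤ w := by
      refine le_of_sq_le_sq ?_ (zero_le_one.trans
        ((le_max_left _ _).trans (one_add_norm_le_weight hx)))
      rw [norm_smul, mul_pow, norm_headProj_sq, Real.norm_eq_abs, sq_abs, sq, mul_assoc,
        inv_mul_cancel₀ hs.ne', mul_one]
      exact inv_sqNormFirst_le_weight hj hx
    have h2 := abs_mul_inner_le (a := a) (p := p) h1
    have h3 : |(j - 2) * (a ^ 2 * (sqNormFirst j x)⁻¹)| ≤ |(j : ℝ) - 2| * (a ^ 2 * w ^ 2) := by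
      rw [abs_mul, abs_of_nonneg (a := a ^ 2 * _) (by positivity)]
      gcongr
      exact inv_sqNormFirst_le_weight hj hx
    have h4 : (2 * (a * inner ℝ p (headProj j x)) + (j - 2) * a ^ 2) / sqNormFirst j x =
        2 * (a * inner ℝ p ((sqNormFirst j x)⁻¹ • headProj j x)) +
          (j - 2) * (a ^ 2 * (sqNormFirst j x)⁻¹) := by
      rw [real_inner_smul_right]
      ring
    rw [h4]
    refine (abs_add_le _ _).trans ?_
    have := mul_nonneg (abs_nonneg ((j : ℝ) - 2)) (sq_nonneg ‖p‖)
    nlinarith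
  simp only [fun N => (isTestFunction_truncatedRadial (n := n) C N).integral_headProj_div hj hjn]
    at hlim
  have hz := tendsto_nhds_unique hlim tendsto_const_nhds
  have key : ∀ x ∈ halfSpace n,
      (2 * (gaussianRadial C x * inner ℝ (gaussianRadial C x • (radialField C x - x))
        (headProj j x)) + (j - 2) * gaussianRadial C x ^ 2) / sqNormFirst j x =
      ((j - 2 + 2 * C j) * (|gaussianRadial C x| ^ 2 / sqNormFirst j x) +
      ∑ i ∈ Finset.Ico j n, 2 * (C (i + 1) - C i) *
        (|gaussianRadial C x| ^ 2 / sqNormFirst (i + 1) x)) - 2 * gaussianRadial C x ^ 2 := by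
    intro x hx
    have hs := (sqNormFirst_pos hj hx).ne'
    have h1 := inner_radialField_headProj h0 hx hj hjn
    have h2 : inner ℝ x (headProj j x) = sqNormFirst j x := by
      rw [← inner_headProj_headProj hjn, headProj_of_le le_rfl, real_inner_comm]
    have h3 : ∑ i ∈ Finset.Ico j n, 2 * (C (i + 1) - C i) *
        (|gaussianRadial C x| ^ 2 / sqNormFirst (i + 1) x) = 2 * gaussianRadial C x ^ 2 *
          ∑ i ∈ Finset.Ico j n, (C (i + 1) - C i) / sqNormFirst (i + 1) x := by
      rw [Finset.mul_sum]
      refine Finset.sum_congr rfl fun i _ => ?_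
      rw [sq_abs]; ring
    rw [h3, ← sub_eq_iff_eq_add'.mpr h1, real_inner_smul_left, inner_sub_left, h2, sq_abs]
    field_simp
    ring
  rw [setIntegral_congr_fun isOpen_halfSpace.measurableSet key] at hz
  have i1 : IntegrableOn (fun x => (j - 2 + 2 * C j) *
      (|gaussianRadial C x| ^ 2 / sqNormFirst j x)) (halfSpace n) :=
    (tendsto_hardyIntegral_truncatedRadial hW hj).1.const_mul _
  have i2 : ∀ i ∈ Finset.Ico j n, IntegrableOn (fun x => 2 * (C (i + 1) - C i) *
        (|gaussianRadial C x| ^ 2 / sqNormFirst (i + 1) x)) (halfSpace n) := fun i _ =>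
    (tendsto_hardyIntegral_truncatedRadial hW (by omega)).1.const_mul _
  rw [integral_sub (by exact i1.add (integrable_finsetSum _ i2))
    ((integrableOn_gaussianRadial_sq hW).const_mul _),
    integral_add i1 (integrable_finsetSum _ i2), integral_finsetSum _ i2] at hz
  simp only [integral_const_mul, mul_assoc, ← Finset.mul_sum] at hz
  simp only [hardyIntegral]
  linarith

/-- The same argument against the field x, using Euler's relation. -/
theorem integral_gaussianRadial_norm_sq (h0 : C 0 = 0)
    (hW : IntegrableOn (gaussianWeight C) (halfSpace n)) :
    ∫ x in halfSpace n, gaussianRadial C x ^ 2 * ‖x‖ ^ 2 =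
      (n / 2 + C n) * ∫ x in halfSpace n, gaussianRadial C x ^ 2 := by
  have hlim := (tendsto_integral_truncatedRadial (n := n) C hW
    (Ψ := fun x a p => 2 * (a * inner ℝ p x) + n * a ^ 2)
    (fun f p hf hp => ?_) (K := 1 + n) (by positivity) ?_).2
  rotate_left
  · exact (continuousOn_const.mul (hf.mul (hp.inner continuousOn_id))).add
      (continuousOn_const.mul (hf.pow 2))
  · intro x hx a p
    have hw := one_add_norm_le_weight hx
    set w := (1 + ‖x‖ ^ 2) / x 0
    have h1 : 1 ≤ w ^ 2 := one_le_pow₀ ((le_max_left _ _).trans hw)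
    have h2 := abs_mul_inner_le (a := a) (p := p) ((le_max_right _ _).trans hw)
    have h3 : |n * a ^ 2| ≤ n * (a ^ 2 * w ^ 2) := by
      rw [abs_of_nonneg (by positivity)]
      gcongr
      nlinarith [mul_le_mul_of_nonneg_left h1 (sq_nonneg a)]
    refine (abs_add_le _ _).trans ?_
    have := mul_nonneg (Nat.cast_nonneg (α := ℝ) n) (sq_nonneg ‖p‖)
    nlinarith
  simp only [fun N => (isTestFunction_truncatedRadial (n := n) C N).integral_inner_self] at hlim
  have hz := tendsto_nhds_unique hlim tendsto_const_nhds
  have key : ∀ x ∈ halfSpace n,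
      2 * (gaussianRadial C x * inner ℝ (gaussianRadial C x • (radialField C x - x)) x) +
        n * gaussianRadial C x ^ 2 =
      (n + 2 * C n) * gaussianRadial C x ^ 2 - 2 * (gaussianRadial C x ^ 2 * ‖x‖ ^ 2) := by
    intro x hx
    rw [real_inner_smul_left, inner_sub_left, inner_radialField_self h0 hx,
      real_inner_self_eq_norm_sq]
    ring
  rw [setIntegral_congr_fun isOpen_halfSpace.measurableSet key,
    integral_sub ((integrableOn_gaussianRadial_sq hW).const_mul _)
      ((integrableOn_gaussianRadial_sq_mul_norm_sq hW).const_mul _),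
    integral_const_mul, integral_const_mul] at hz
  linarith

/-- Subtracting the field of the ground state from the logarithmic gradient of the trial function
leaves only the field of B minus x, whose square norm is expanded here. -/
theorem tendsto_hardyDeficit_truncatedRadial {k M : ℕ} (hk : 1 ≤ k) (hkM : k ≤ M) (hM : M ≤ n)
    {B : ℕ → ℝ} (hB : B 0 = 0)
    (hW : IntegrableOn (gaussianWeight (groundDegree k M + B)) (halfSpace n)) :
    Filter.Tendsto (fun N => hardyDeficit n k M (truncatedRadial (groundDegree k M + B) N))
      Filter.atTop
      (nhds (∑ j ∈ Finset.range n, (B (j + 1) ^ 2 - B j ^ 2) *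
          hardyIntegral n (j + 1) (gaussianRadial (groundDegree k M + B)) -
        2 * B n * (∫ x in halfSpace n, gaussianRadial (groundDegree k M + B) x ^ 2) +
        ∫ x in halfSpace n, gaussianRadial (groundDegree k M + B) x ^ 2 * ‖x‖ ^ 2)) := by
  set A := groundDegree k M with hA
  set v : EuclideanSpace ℝ (Fin n) → ℝ := gaussianRadial (A + B) with hv
  have hlim := (tendsto_integral_truncatedRadial (n := n) (A + B) hW
    (Ψ := fun x a p => ‖p - a • radialField A x‖ ^ 2)
    (fun f p hf hp => (hp.sub (hf.smul (continuousOn_radialField A))).norm.pow 2)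
    (K := 2 * (1 + (∑ j ∈ Finset.range n, |A (j + 1) - A j|) ^ 2)) (by positivity) ?_).2
  rotate_left
  · intro x hx a p
    have hx0 : 0 < x 0 := hx
    set w := (1 + ‖x‖ ^ 2) / x 0 with hw
    set S := ∑ j ∈ Finset.range n, |A (j + 1) - A j| with hS
    have hS0 : 0 ≤ S := Finset.sum_nonneg fun _ _ => abs_nonneg _
    have h1 : ‖radialField A x‖ ≤ S * w := by
      refine (norm_radialField_le A hx).trans ?_
      rw [← mul_one_div]
      exact mul_le_mul_of_nonneg_left (one_div_le_weight hx) hS0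
    have h2 : ‖p - a • radialField A x‖ ≤ ‖p‖ + |a| * (S * w) := by
      refine (norm_sub_le _ _).trans ?_
      rw [norm_smul, Real.norm_eq_abs]
      gcongr
    have h3 := pow_le_pow_left₀ (norm_nonneg _) h2 2
    rw [abs_of_nonneg (by positivity)]
    have h4 : 0 ≤ S ^ 2 * ‖p‖ ^ 2 := by positivity
    have h5 : 0 ≤ a ^ 2 * w ^ 2 := by positivity
    nlinarith [sq_nonneg (‖p‖ - |a| * (S * w)), sq_abs a, mul_pow |a| (S * w) 2, mul_pow S w 2]
  simp only [fun N => ((isTestFunction_truncatedRadial (n := n) (A + B) N).hardyDeficit_eq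
    hk hkM hM)]
  convert! hlim using 2
  have key : ∀ x ∈ halfSpace n, ‖v x • (radialField (A + B) x - x) - v x • radialField A x‖ ^ 2 =
      (∑ j ∈ Finset.range n, (B (j + 1) ^ 2 - B j ^ 2) * (|v x| ^ 2 / sqNormFirst (j + 1) x) -
        2 * B n * v x ^ 2) + v x ^ 2 * ‖x‖ ^ 2 := by
    intro x hx
    rw [← smul_sub, radialField_add,
      show radialField A x + radialField B x - x - radialField A x = radialField B x - x by abel,
      norm_smul, mul_pow, norm_sub_sq_real, norm_radialField_sq hB hx,
      inner_radialField_self hB hx, Real.norm_eq_abs, sq_abs, mul_add, mul_sub, Finset.mul_sum]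
    congr 2
    · refine Finset.sum_congr rfl fun j _ => ?_
      ring
    · ring
  have i1 : ∀ j ∈ Finset.range n, IntegrableOn (fun x => (B (j + 1) ^ 2 - B j ^ 2) *
      (|v x| ^ 2 / sqNormFirst (j + 1) x)) (halfSpace n) := fun j _ =>
    (tendsto_hardyIntegral_truncatedRadial hW (by omega)).1.const_mul _
  have i2 : IntegrableOn (fun x => 2 * B n * v x ^ 2) (halfSpace n) :=
    (integrableOn_gaussianRadial_sq hW).const_mul _
  rw [setIntegral_congr_fun isOpen_halfSpace.measurableSet key,
    integral_add (by exact (integrable_finsetSum _ i1).sub i2)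
      (integrableOn_gaussianRadial_sq_mul_norm_sq hW),
    integral_sub (integrable_finsetSum _ i1) i2, integral_finsetSum _ i1]
  simp only [integral_const_mul]
  rfl

end Limit

/-! ### Perturbed exponents and integrability of the weight. -/

/-- Admissible perturbations of the exponents of the ground state. -/
structure IsPerturbation (k M : ℕ) (B : ℕ → ℝ) : Prop where
  eq_zero : ∀ j < k, B j = 0
  pos : ∀ j, k ≤ j → 0 < B j
  lt_succ : ∀ j, k ≤ j → j < M → B j < B (j + 1)
  le_half : ∀ j, B j ≤ 1 / 2
  eq_last : ∀ j, M ≤ j → B j = B M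

section Integrability

variable {n : ℕ} {k M : ℕ} {B : ℕ → ℝ}

theorem integrable_abs_rpow_mul_exp {s : ℝ} (hs : -1 < s) :
    Integrable fun t : ℝ => |t| ^ s * Real.exp (-(1 / 2) * t ^ 2) := by
  have h1 : IntegrableOn (fun t : ℝ => |t| ^ s * Real.exp (-(1 / 2) * t ^ 2)) (Set.Ioi 0) := by
    refine (integrableOn_congr_fun (fun t ht => ?_) measurableSet_Ioi).mp
      (integrableOn_rpow_mul_exp_neg_mul_sq (b := 1 / 2) (by norm_num) hs)
    simp only [abs_of_pos (Set.mem_Ioi.mp ht)]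
  rw [← integrableOn_univ, ← Set.Iio_union_Ici (a := (0 : ℝ)), integrableOn_union,
    integrableOn_Ici_iff_integrableOn_Ioi]
  refine ⟨?_, h1⟩
  rw [← (Measure.measurePreserving_neg volume).integrableOn_comp_preimage
    (MeasurableEquiv.neg ℝ).measurableEmbedding] at h1
  simpa [Function.comp_def] using h1

theorem integrable_prod_abs_rpow_mul_exp {q : Fin n → ℝ} (hq : ∀ i, -1 < q i) :
    Integrable fun x : EuclideanSpace ℝ (Fin n) =>
      ∏ i, |x i| ^ q i * Real.exp (-(1 / 2) * x i ^ 2) :=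
  (PiLp.volume_preserving_ofLp (Fin n)).integrable_comp_of_integrable
    (Integrable.fintype_prod (μ := fun _ : Fin n => (volume : Measure ℝ))
      (f := fun i t => |t| ^ q i * Real.exp (-(1 / 2) * t ^ 2))
      fun i => integrable_abs_rpow_mul_exp (hq i))

theorem ae_forall_apply_ne_zero : ∀ᵐ x : EuclideanSpace ℝ (Fin n), ∀ i, x i ≠ 0 := by
  rw [ae_all_iff]
  intro i
  exact (PiLp.volume_preserving_ofLp (Fin n)).quasiMeasurePreserving.ae
    (Measure.ae_eval_ne (μ := fun _ : Fin n => (volume : Measure ℝ)) i 0)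

/-- The exponents of a product of powers of the coordinates dominating the ground state. -/
noncomputable def dominatingExponent (k : ℕ) (C : ℕ → ℝ) (i : ℕ) : ℝ :=
  if i < k then (C k - 1) / k else C (i + 1) - C i

theorem IsPerturbation.nonneg (hB : IsPerturbation k M B) (j : ℕ) : 0 ≤ B j := by
  rcases lt_or_ge j k with h | h
  · exact (hB.eq_zero j h).ge
  · exact (hB.pos j h).le

/-- Positivity and strict growth of B push the exponents above the critical value -1/2, where
|t|^(2q) becomes integrable at 0. The bound B ≤ 1/2 keeps them nonpositive. -/
theorem IsPerturbation.dominatingExponent_mem (hB : IsPerturbation k M B) (hk : 1 ≤ k)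
    (hkM : k ≤ M) (i : ℕ) :
    dominatingExponent k (groundDegree k M + B) i ∈ Set.Ioc (-(1 / 2) : ℝ) 0 := by
  have hk0 : (1 : ℝ) ≤ k := by exact_mod_cast hk
  rw [dominatingExponent]
  simp only [Pi.add_apply]
  split_ifs with h
  · rw [groundDegree_of_le hk le_rfl hkM]
    have h1 := hB.pos k le_rfl
    have h2 := hB.le_half k
    constructor
    · rw [lt_div_iff₀ (by linarith)]; linarith
    · exact div_nonpos_of_nonpos_of_nonneg (by linarith) (by linarith)
  · rcases lt_or_ge i M with hi | hi
    · rw [groundDegree_of_le hk (by omega) hi.le, groundDegree_of_le hk (by omega) (by omega)]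
      have h1 := hB.lt_succ i (by omega) hi
      have h2 := hB.le_half (i + 1)
      have h3 := hB.nonneg i
      push_cast
      constructor <;> linarith
    · rw [groundDegree_of_ge hk hkM hi, groundDegree_of_ge hk hkM (by omega), hB.eq_last i hi,
        hB.eq_last (i + 1) (by omega)]
      norm_num

variable [NeZero n]

theorem sqNormFirst_one (x : EuclideanSpace ℝ (Fin n)) : sqNormFirst 1 x = x 0 ^ 2 := by
  have : (Finset.univ.filter fun i : Fin n => (i : ℕ) < 1) = {0} := by
    ext i
    rw [Finset.mem_filter, Finset.mem_singleton, Fin.ext_iff, Fin.val_zero, Nat.lt_one_iff]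
    exact and_iff_right (Finset.mem_univ i)
  rw [sqNormFirst, this, Finset.sum_singleton]

/-- A nonpositive power of |X_j| is at most the same power of any |x_i| with i among the first j
coordinates. The power of |X_k| is shared equally among its k coordinates; each later |X_{i+1}| is
charged to its newest coordinate. -/
theorem sum_mul_log_sqNormFirst_le {C : ℕ → ℝ} (hk : 1 ≤ k) (hkn : k ≤ n) (h0 : C 0 = 0)
    (h1 : ∀ j, 1 ≤ j → j < k → C j = 1) (hq : ∀ i, dominatingExponent k C i ≤ 0)
    {x : EuclideanSpace ℝ (Fin n)} (hx : ∀ i, x i ≠ 0) :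
    ∑ j ∈ Finset.range n, (C (j + 1) - C j) * Real.log (sqNormFirst (j + 1) x) ≤
      Real.log (x 0 ^ 2) + ∑ i : Fin n, dominatingExponent k C i * Real.log (x i ^ 2) := by
  set y : ℕ → ℝ := fun i => if h : i < n then Real.log (x ⟨i, h⟩ ^ 2) else 0 with hy
  have hyl : ∀ i j : ℕ, i < j → i < n → y i ≤ Real.log (sqNormFirst j x) := by
    intro i j hij hin
    simp only [hy, dif_pos hin]
    exact Real.log_le_log (by have := hx ⟨i, hin⟩; positivity)
      (sq_le_sqNormFirst ⟨i, hin⟩ hij x)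
  have hsum : ∑ i : Fin n, dominatingExponent k C i * Real.log (x i ^ 2) =
      ∑ i ∈ Finset.range n, dominatingExponent k C i * y i := by
    rw [← Fin.sum_univ_eq_sum_range (fun i => dominatingExponent k C i * y i)]
    refine Finset.sum_congr rfl fun i _ => ?_
    simp [hy]
  rw [hsum, ← Finset.sum_range_add_sum_Ico _ hkn, ← Finset.sum_range_add_sum_Ico _ hkn,
    ← add_assoc]
  refine add_le_add ?_ ?_
  -- The exponents strictly between the first and the k-th vanish, leaving only x₁ and |X_k|.
  · have e1 : ∑ j ∈ Finset.range k, (C (j + 1) - C j) * Real.log (sqNormFirst (j + 1) x) =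
        Real.log (x 0 ^ 2) + (C k - 1) * Real.log (sqNormFirst k x) := by
      obtain ⟨m, rfl⟩ : ∃ m, k = m + 1 := ⟨k - 1, by omega⟩
      rw [Finset.sum_range_succ]
      rcases Nat.eq_zero_or_pos m with rfl | hm
      · simp only [Finset.range_zero, Finset.sum_empty, zero_add, h0, sqNormFirst_one]
        ring
      · rw [Finset.sum_eq_single_of_mem 0 (by simpa using hm)]
        · rw [zero_add, h0, h1 1 le_rfl (by omega), h1 m hm (by omega), sqNormFirst_one]
          ring
        · intro j hj hj0
          rw [Finset.mem_range] at hj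
          rw [h1 j (by omega) (by omega), h1 (j + 1) (by omega) (by omega)]
          ring
    rw [e1]
    refine add_le_add le_rfl ?_
    have hk0 : (k : ℝ) ≠ 0 := by positivity
    calc (C k - 1) * Real.log (sqNormFirst k x)
        = ∑ i ∈ Finset.range k, (C k - 1) / k * Real.log (sqNormFirst k x) := by
          rw [Finset.sum_const, Finset.card_range, nsmul_eq_mul]; field_simp
      _ ≤ _ := Finset.sum_le_sum fun i hi => by
          rw [Finset.mem_range] at hi
          have h2 := hq i
          rw [dominatingExponent, if_pos hi] at h2 ⊢
          exact mul_le_mul_of_nonpos_left (hyl i k hi (by omega)) h2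
  · refine Finset.sum_le_sum fun i hi => ?_
    rw [Finset.mem_Ico] at hi
    have h2 := hq i
    rw [dominatingExponent, if_neg (by omega)] at h2 ⊢
    exact mul_le_mul_of_nonpos_left (hyl i (i + 1) (by omega) hi.2) h2

theorem continuousOn_gaussianWeight (C : ℕ → ℝ) :
    ContinuousOn (gaussianWeight C : EuclideanSpace ℝ (Fin n) → ℝ) (halfSpace n) := by
  have h1 : ContinuousOn (gaussianRadial C : EuclideanSpace ℝ (Fin n) → ℝ) (halfSpace n) :=
    fun x hx => (contDiffAt_gaussianRadial C hx).continuousAt.continuousWithinAt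
  refine (h1.pow 2).mul (ContinuousOn.pow (ContinuousOn.div (by fun_prop) (by fun_prop) ?_) 2)
  exact fun x hx => ne_of_gt hx

theorem IsPerturbation.integrableOn_gaussianWeight (hB : IsPerturbation k M B) (hk : 1 ≤ k)
    (hkM : k ≤ M) (hM : M ≤ n) :
    IntegrableOn (gaussianWeight (groundDegree k M + B)) (halfSpace n) := by
  set C := groundDegree k M + B with hC
  have hq := hB.dominatingExponent_mem hk hkM
  rw [← hC] at hq
  have h0 : C 0 = 0 := by
    rw [hC, Pi.add_apply, groundDegree_zero, hB.eq_zero 0 (by omega), add_zero]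
  have h1 : ∀ j, 1 ≤ j → j < k → C j = 1 := fun j hj hjk => by
    rw [hC, Pi.add_apply, groundDegree_of_lt hj hjk, hB.eq_zero j hjk, add_zero]
  have hint := ((integrable_prod_abs_rpow_mul_exp (n := n)
    (q := fun i => 2 * dominatingExponent k C i)
    (fun i => by have := (hq i).1; linarith)).const_mul 16).integrableOn (s := halfSpace n)
  refine hint.mono' ((continuousOn_gaussianWeight C).aestronglyMeasurable
    isOpen_halfSpace.measurableSet) ?_
  filter_upwards [ae_restrict_mem isOpen_halfSpace.measurableSet,
    ae_restrict_of_ae ae_forall_apply_ne_zero] with x hx hne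
  have hx0 : 0 < x 0 := hx
  have hle := sum_mul_log_sqNormFirst_le hk (hkM.trans hM) h0 h1 (fun i => (hq i).2) hne
  have hprod : ∏ i, |x i| ^ (2 * dominatingExponent k C i) * Real.exp (-(1 / 2) * x i ^ 2) =
      Real.exp (∑ i : Fin n, dominatingExponent k C i * Real.log (x i ^ 2) - ‖x‖ ^ 2 / 2) := by
    rw [EuclideanSpace.norm_sq_eq, Finset.sum_div, ← Finset.sum_sub_distrib, Real.exp_sum]
    refine Finset.prod_congr rfl fun i _ => ?_
    rw [Real.rpow_def_of_pos (abs_pos.mpr (hne i)), ← Real.exp_add, Real.log_pow, Real.log_abs,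
      Real.norm_eq_abs, sq_abs]
    congr 1
    push_cast
    ring
  -- Half of the Gaussian factor exp(-|x|²) absorbs the polynomial; the other half ensures
  -- integrability.
  have hpoly : (1 + ‖x‖ ^ 2) ^ 2 ≤ 16 * Real.exp (‖x‖ ^ 2 / 2) := by
    have h2 : 1 + ‖x‖ ^ 2 ≤ 4 * Real.exp (‖x‖ ^ 2 / 4) := by
      have := Real.add_one_le_exp (‖x‖ ^ 2 / 4)
      linarith
    calc (1 + ‖x‖ ^ 2) ^ 2 ≤ (4 * Real.exp (‖x‖ ^ 2 / 4)) ^ 2 :=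
          pow_le_pow_left₀ (by positivity) h2 2
      _ = _ := by rw [mul_pow, ← Real.exp_nat_mul]; norm_num; ring_nf
  have hsq : gaussianRadial C x ^ 2 / x 0 ^ 2 ≤
      Real.exp (∑ i : Fin n, dominatingExponent k C i * Real.log (x i ^ 2) - ‖x‖ ^ 2) := by
    rw [div_le_iff₀ (by positivity)]
    rw [← Real.exp_log (pow_pos hx0 2), gaussianRadial, ← Real.exp_nat_mul, ← Real.exp_add, Real.exp_le_exp]
    have : ∑ j ∈ Finset.range n, (C (j + 1) - C j) * Real.log (sqNormFirst (j + 1) x) =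
        2 * ∑ j ∈ Finset.range n, (C (j + 1) - C j) / 2 * Real.log (sqNormFirst (j + 1) x) := by
      rw [Finset.mul_sum]
      exact Finset.sum_congr rfl fun j _ => by ring
    push_cast
    linarith
  rw [hprod, gaussianWeight, Real.norm_eq_abs, abs_of_nonneg (by positivity)]
  calc gaussianRadial C x ^ 2 * ((1 + ‖x‖ ^ 2) / x 0) ^ 2
      = gaussianRadial C x ^ 2 / x 0 ^ 2 * (1 + ‖x‖ ^ 2) ^ 2 := by rw [div_pow]; ring
    _ ≤ Real.exp (∑ i : Fin n, dominatingExponent k C i * Real.log (x i ^ 2) - ‖x‖ ^ 2) *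
        (16 * Real.exp (‖x‖ ^ 2 / 2)) := by gcongr
    _ = _ := by
      rw [mul_left_comm, ← Real.exp_add]
      ring_nf

end Integrability

/-! ### Choosing the perturbation. -/

/-- Downward induction on k from M. The constants depend on B but not on J or G, so B may be fixed
before the trial function and its integrals exist. The bounds J j ≤ A J M serve only the induction:
they control the recursion at the next smaller index. -/
theorem exists_isPerturbation {M : ℕ} {c : ℝ} (hc : 0 ≤ c) (d : ℕ) :
    ∀ (k : ℕ) (η : ℝ), 0 < η → k + d = M → ∃ B, IsPerturbation k M B ∧ ∃ A, 0 ≤ A ∧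
      ∀ (J : ℕ → ℝ) (G : ℝ), (∀ j, 0 ≤ J j) → B M * J M = G →
      (∀ j, k ≤ j → j ≤ M → B j * J j ≤ G + 1 / 2 * ∑ i ∈ Finset.Ico j M, J (i + 1)) →
      (∀ j, k ≤ j → j ≤ M → J j ≤ A * J M) ∧
        ∑ j ∈ Finset.Icc k M, B j ^ 2 * J j + c * G ≤ η * J M := by
  induction d with
  | zero =>
    rintro k η hη rfl
    rw [add_zero]
    -- With G = ε J M the quantity to bound is (ε² + c ε) J M ≤ ε (1 + c) J M.
    set ε := min (1 / 2) (η / (1 + c))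
    have hε : 0 < ε := lt_min (by norm_num) (by positivity)
    have hε1 : ε ≤ 1 / 2 := min_le_left _ _
    have hε2 : ε * (1 + c) ≤ η := (le_div_iff₀ (by positivity)).mp (min_le_right _ _)
    refine ⟨fun j => if j < k then 0 else ε, ⟨fun j hj => if_pos hj, fun j hj => ?_,
      fun j hj hj' => by omega, fun j => ?_, fun j hj => ?_⟩, 1, zero_le_one, ?_⟩
    · rwa [if_neg (by omega)]
    · split_ifs
      · norm_num
      · exact hε1
    · rw [if_neg (by omega), if_neg (by omega)]
    · intro J G hJ hG _
      beta_reduce at hG ⊢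
      rw [if_neg (lt_irrefl k)] at hG
      refine ⟨fun j hj hj' => by rw [le_antisymm hj' hj, one_mul], ?_⟩
      rw [Finset.Icc_self, Finset.sum_singleton, if_neg (lt_irrefl k), ← hG]
      have h1 := mul_le_mul_of_nonneg_right hε2 (hJ k)
      have h2 := mul_nonneg hε.le (hJ k)
      nlinarith
  | succ d ih =>
    intro k η hη hkd
    obtain ⟨B, hB, A, hA, hBA⟩ := ih (k + 1) (η / 2) (by positivity) (by omega)
    have hBk := hB.pos (k + 1) le_rfl
    have hBM := hB.pos M (by omega)
    -- The recursion at k gives b J k ≤ A1 J M for whatever b is chosen as B k.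
    set A1 := B M + 1 / 2 * (M * A) with hA1
    have hA1pos : 0 < A1 := by positivity
    -- The first bound keeps B strictly increasing; the second gives b² J k ≤ b A1 J M ≤ (η/2) J M.
    set b := min (B (k + 1) / 2) (η / 2 / A1)
    have hb : 0 < b := lt_min (by positivity) (by positivity)
    have hb1 : b ≤ B (k + 1) / 2 := min_le_left _ _
    have hb2 : b * A1 ≤ η / 2 := (le_div_iff₀ hA1pos).mp (min_le_right _ _)
    have hne : ∀ j, j ≠ k → Function.update B k b j = B j := fun j hj =>
      Function.update_of_ne hj _ _
    have hup : Function.update B k b k = b := Function.update_self _ _ _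
    refine ⟨Function.update B k b, ⟨fun j hj => ?_, fun j hj => ?_, fun j hj hj' => ?_,
      fun j => ?_, fun j hj => ?_⟩, A + A1 / b, by positivity, ?_⟩
    · rw [hne j hj.ne, hB.eq_zero j (by omega)]
    · rcases hj.eq_or_lt with rfl | hj
      · rwa [hup]
      · rw [hne j hj.ne']; exact hB.pos j hj
    · rcases hj.eq_or_lt with rfl | hj
      · rw [hup, hne _ (by omega)]; linarith
      · rw [hne j hj.ne', hne _ (by omega)]; exact hB.lt_succ j hj hj'
    · rcases eq_or_ne j k with rfl | hj
      · rw [hup]; have := hB.le_half (j + 1); linarith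
      · rw [hne j hj]; exact hB.le_half j
    · rw [hne j (by omega), hne M (by omega)]; exact hB.eq_last j hj
    · intro J G hJ hG hrec
      rw [hne M (by omega)] at hG
      obtain ⟨h1, h2⟩ := hBA J G hJ hG fun j hj hj' => by
        have := hrec j (by omega) hj'
        rwa [hne j (by omega)] at this
      have h3 : ∑ i ∈ Finset.Ico k M, J (i + 1) ≤ M * (A * J M) := by
        refine (Finset.sum_le_card_nsmul _ _ (A * J M) fun i hi => ?_).trans ?_
        · rw [Finset.mem_Ico] at hi
          exact h1 (i + 1) (by omega) (by omega)
        · rw [nsmul_eq_mul, Nat.card_Ico]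
          have := hJ M
          gcongr
          omega
      have h4 : b * J k ≤ A1 * J M := by
        have := hrec k le_rfl (by omega)
        rw [hup] at this
        rw [hA1]
        linarith
      have hAb : 0 ≤ A1 / b * J M := mul_nonneg (by positivity) (hJ M)
      refine ⟨fun j hj hj' => ?_, ?_⟩
      · rw [add_mul]
        rcases hj.eq_or_lt with rfl | hj
        · have : J k ≤ A1 / b * J M := by
            rw [div_mul_eq_mul_div, le_div_iff₀ hb]; linarith
          have := mul_nonneg hA (hJ M)
          linarith
        · have := h1 j hj hj'
          linarith
      · rw [← Finset.add_sum_Ioc_eq_sum_Icc (by omega : k ≤ M), hup]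
        have h5 : ∑ j ∈ Finset.Ioc k M, Function.update B k b j ^ 2 * J j =
            ∑ j ∈ Finset.Icc (k + 1) M, B j ^ 2 * J j := by
          refine Finset.sum_congr (by ext; simp) fun j hj => ?_
          rw [hne j (by have := (Finset.mem_Icc.mp hj).1; omega)]
        rw [h5]
        have h6 := mul_le_mul_of_nonneg_left h4 hb.le
        have h7 := mul_le_mul_of_nonneg_right hb2 (hJ M)
        nlinarith

/-! ### Near-optimal test functions and the two infima. -/

section Sharpness

variable {n : ℕ} [NeZero n] {k M : ℕ}

theorem exists_hardyDeficit_le (hk : 1 ≤ k) (hkM : k ≤ M) (hM : M ≤ n) {ε : ℝ} (hε : 0 < ε) :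
    ∃ u, IsTestFunction n u ∧ u ≠ 0 ∧ hardyDeficit n k M u ≤ ε * hardyIntegral n M u := by
  -- The constant n/2 + 2 bounds n/2 + C n, the coefficient of G in the limiting deficit. Asking for
  -- ε/2 leaves room for passing to a truncation.
  obtain ⟨B, hB, A, -, hBA⟩ := exists_isPerturbation (M := M) (c := (n : ℝ) / 2 + 2)
    (by positivity) (M - k) k (ε / 2) (by positivity) (by omega)
  have hW := hB.integrableOn_gaussianWeight hk hkM hM
  have hB0 : B 0 = 0 := hB.eq_zero 0 (by omega)
  set C := groundDegree k M + B with hC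
  have hC0 : C 0 = 0 := by rw [hC, Pi.add_apply, groundDegree_zero, hB0, add_zero]
  have hCmid : ∀ j, k ≤ j → j ≤ M → C j = 1 - (j : ℝ) / 2 + B j := fun j h1 h2 => by
    rw [hC, Pi.add_apply, groundDegree_of_le hk h1 h2]
  have hClast : ∀ j, M ≤ j → C j = 1 - (M : ℝ) / 2 + B M := fun j h1 => by
    rw [hC, Pi.add_apply, groundDegree_of_ge hk hkM h1, hB.eq_last j h1]
  set v : EuclideanSpace ℝ (Fin n) → ℝ := gaussianRadial C with hv
  set J : ℕ → ℝ := fun j => hardyIntegral n j v with hJdef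
  have hJ0 : ∀ j, 0 ≤ J j := fun j =>
    integral_nonneg fun x => div_nonneg (by positivity) (sqNormFirst_nonneg j x)
  have hJM : 0 < J M := hardyIntegral_gaussianRadial_pos hW (by omega)
  set G := ∫ x in halfSpace n, v x ^ 2 with hG
  have hG0 : 0 ≤ G := integral_nonneg fun _ => sq_nonneg _
  have hrel : ∀ j, k ≤ j → j ≤ M →
      B j * J j + ∑ i ∈ Finset.Ico j M, (C (i + 1) - C i) * J (i + 1) = G := by
    intro j h1 h2
    have h3 := integral_gaussianRadial_headProj hC0 hW (j := j) (by omega) (by omega)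
    rw [← Finset.sum_Ico_consecutive _ h2 hM, Finset.sum_eq_zero (s := Finset.Ico M n) fun i hi => by
      rw [Finset.mem_Ico] at hi
      rw [hClast i hi.1, hClast (i + 1) (by omega), sub_self, zero_mul], add_zero,
      hCmid j h1 h2] at h3
    simp only [hJdef, hG, hv]
    linarith
  have hlast : B M * J M = G := by simpa using hrel M hkM le_rfl
  -- Between k and M the increments of C are -1/2 plus a positive increment of B, so the exact
  -- relation weakens to the required inequality.
  obtain ⟨-, hsum⟩ := hBA J G hJ0 hlast fun j h1 h2 => by
    have h3 := hrel j h1 h2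
    have h4 : ∑ i ∈ Finset.Ico j M, (-(1 / 2) : ℝ) * J (i + 1) ≤
        ∑ i ∈ Finset.Ico j M, (C (i + 1) - C i) * J (i + 1) := by
      refine Finset.sum_le_sum fun i hi => mul_le_mul_of_nonneg_right ?_ (hJ0 _)
      rw [Finset.mem_Ico] at hi
      rw [hCmid i (by omega) (by omega), hCmid (i + 1) (by omega) (by omega)]
      have := hB.lt_succ i (by omega) hi.2
      push_cast
      linarith
    rw [← Finset.mul_sum] at h4
    linarith
  have hlim := tendsto_hardyDeficit_truncatedRadial hk hkM hM hB0 hW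
  rw [integral_gaussianRadial_norm_sq hC0 hW] at hlim
  set E := ∑ j ∈ Finset.range n, (B (j + 1) ^ 2 - B j ^ 2) * J (j + 1) - 2 * B n * G +
    ((n : ℝ) / 2 + C n) * G with hE
  have hlim' : Filter.Tendsto (fun N => hardyDeficit n k M (truncatedRadial C N)) Filter.atTop
    (nhds E) := hlim
  have hEle : E ≤ ε / 2 * J M := by
    refine le_trans ?_ hsum
    -- The terms -B_j² J_{j+1} are discarded; outside k ≤ j+1 ≤ M the two squares cancel.
    have e1 : ∑ j ∈ Finset.range n, (B (j + 1) ^ 2 - B j ^ 2) * J (j + 1) ≤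
        ∑ j ∈ Finset.Icc k M, B j ^ 2 * J j := by
      have e2 := Finset.sum_Ico_add' (fun j => if j ∈ Finset.Icc k M then B j ^ 2 * J j else 0)
        0 n 1
      rw [← Finset.range_eq_Ico] at e2
      have e3 : ∑ j ∈ Finset.Ico (0 + 1) (n + 1),
          (if j ∈ Finset.Icc k M then B j ^ 2 * J j else 0) =
            ∑ j ∈ Finset.Icc k M, B j ^ 2 * J j := by
        rw [← Finset.sum_filter, Finset.filter_mem_eq_inter, Finset.inter_eq_right.mpr]
        intro j; simp; omega
      rw [← e3, ← e2]
      refine Finset.sum_le_sum fun j _ => ?_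
      simp only [Finset.mem_Icc]
      split_ifs with h
      · nlinarith [mul_nonneg (sq_nonneg (B j)) (hJ0 (j + 1))]
      · rcases lt_or_ge (j + 1) k with h' | h'
        · rw [hB.eq_zero _ h', hB.eq_zero j (by omega)]; simp
        · rw [hB.eq_last (j + 1) (by omega), hB.eq_last j (by omega)]; simp
    have e4 : C n ≤ 2 := by
      rw [hClast n hM]
      have := hB.le_half M
      have : (0 : ℝ) ≤ M := Nat.cast_nonneg M
      linarith
    have e5 := mul_nonneg (hB.nonneg n) hG0
    have e6 := mul_le_mul_of_nonneg_right e4 hG0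
    rw [hE]
    linarith
  have hhardy := (tendsto_hardyIntegral_truncatedRadial hW (j := M) (by omega)).2
  have hd := hlim'.sub (hhardy.const_mul ε)
  have hneg : E - ε * J M < 0 := by nlinarith
  obtain ⟨N, hN1, hN2⟩ := ((hd.eventually_lt_const hneg).and
    (hhardy.eventually_const_lt hJM)).exists
  refine ⟨truncatedRadial C N, isTestFunction_truncatedRadial C N, ?_, by linarith⟩
  intro h
  rw [h] at hN2
  simp [hardyIntegral] at hN2

/-- Serves both claims: M = k with κ = k²/4, and M = m + 1 with κ = 1/4, where the numerator is the
deficit with its last Hardy term added back. -/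
theorem isGLB_hardyQuotient (hk : 1 ≤ k) (hkM : k ≤ M) (hM : M ≤ n) {κ : ℝ}
    {f : (EuclideanSpace ℝ (Fin n) → ℝ) → ℝ}
    (hf : ∀ u, f u = hardyDeficit n k M u + κ * hardyIntegral n M u) :
    IsGLB {q : ℝ | ∃ u : EuclideanSpace ℝ (Fin n) → ℝ, IsTestFunction n u ∧ u ≠ 0 ∧
      q = f u / hardyIntegral n M u} κ := by
  constructor
  · rintro q ⟨u, hu, hu0, rfl⟩
    have hpos := hu.hardyIntegral_pos hu0 (hk.trans hkM)
    rw [le_div_iff₀ hpos, hf]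
    linarith [hu.hardyDeficit_nonneg hk hkM hM]
  · intro b hb
    refine le_of_forall_pos_le_add fun ε hε => ?_
    obtain ⟨u, hu, hu0, hle⟩ := exists_hardyDeficit_le hk hkM hM hε
    have hpos := hu.hardyIntegral_pos hu0 (hk.trans hkM)
    refine (hb ⟨u, hu, hu0, rfl⟩).trans ?_
    rw [div_le_iff₀ hpos, hf]
    linarith

end Sharpness

theorem mainTheorem6 (n : ℕ) [NeZero n] (k : ℕ) (hk : 1 ≤ k) (hkn : k ≤ n) :
    IsGLB {q : ℝ | ∃ u : EuclideanSpace ℝ (Fin n) → ℝ, IsTestFunction n u ∧ u ≠ 0 ∧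
        q = dirichletIntegral n u / hardyIntegral n k u} ((k : ℝ) ^ 2 / 4) ∧
    ∀ m : ℕ, k ≤ m → m < n →
      IsGLB {q : ℝ | ∃ u : EuclideanSpace ℝ (Fin n) → ℝ, IsTestFunction n u ∧ u ≠ 0 ∧
          q = (dirichletIntegral n u - (k : ℝ) ^ 2 / 4 * hardyIntegral n k u
                - ∑ j ∈ Finset.Icc (k + 1) m, (1 / 4 : ℝ) * hardyIntegral n j u)
              / hardyIntegral n (m + 1) u} (1 / 4 : ℝ) := by
  refine ⟨isGLB_hardyQuotient hk le_rfl hkn fun u => ?_, fun m hkm hmn =>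
    isGLB_hardyQuotient (M := m + 1) hk (by omega) hmn fun u => ?_⟩
  · simp [hardyDeficit]
  · rw [hardyDeficit, Finset.sum_Icc_succ_top (by omega)]
    ring
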